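/- **Setting.** Let $f:\mathbb R^d\to\mathbb R$ be differentiable and bounded below with $\|\nabla f(x)-\nabla f(y)\|\le L\|x-y\|$ for all $x,y$, where $L>0$. Let $\mathcal D$ be a probability distribution and $\nabla f(x;\xi)$ (jointly measurable) stochastic gradients with $\mathbb E_{\xi\sim\mathcal D}[\nabla f(x;\xi)]=\nabla f(x)$ and $\mathbb E_{\xi\sim\mathcal D}\|\nabla f(x;\xi)-\nabla f(x)\|^2\le\sigma^2$ for all $x$, where $\sigma\ge 0$. Let $w^0\in\mathbb R^d$, $\Delta:=f(w^0)-\inf f$, $\varepsilon>0$, and let $b\ge1$ be an integer. **Computation trees.** A computation tree has a root $w^0$ and is built iteratively. Each iteration chooses already computed nodes $w_{\rm base}$, $w_{\rm grad}$, a step size $\gamma$ and a sample $\zeta$ (samples may be reused), and adds the node $w_{\rm new}=w_{\rm base}-\gamma\nabla f(w_{\rm grad};\zeta)$ with an edge from $w_{\rm base}$. A main branch is an infinite path $x^0=w^0,x^1,x^2,\dots$ in the tree; its auxiliary sequence $(\gamma_k,z^k,\xi^k)$, with $\gamma_k>0$ and $\xi^k\sim\mathcal D$, is given by the iterations $x^{k+1}=x^k-\gamma_k\nabla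 f(z^k;\xi^k)$. For nodes $y,z$, $\mathrm{dist}(y,z)$ is the larger of the numbers of edges from their closest common ancestor to $y$ and to $z$; $\mathrm{dist}(y,\{x^k\})=\min_k\mathrm{dist}(y,x^k)$; and $\mathrm{repr}(y)$ is the multiset of the pairs $(w_{\rm grad},\zeta)$ along the path from the root to $y$. **Method (asynchronous Decaying Local SGD with $n$ workers).** In round $r=0,1,2,\dots$, worker $i\in\{1,\dots,n\}$ starts from $z^r_{i,0}=w^r$ and runs $M^r_i$ local steps $$z^r_{i,j+1}=z^r_{i,j}-\eta_j\nabla f(z^r_{i,j};\zeta^r_{i,j}),\qquad \eta_j=\sqrt{\frac{b-1}{(j+1)(\log(b-1)+1)}}\;\eta_g$$ (with $\eta_j=0$ if $b=1$), where $\sum_{i=1}^nM^r_i=b$. Then $w^{r+1}=w^r-\eta_g\sum_{i=1}^n\sum_{j=0}^{M^r_i-1}\nabla f(z^r_{i,j};\zeta^r_{i,j})$. The samples $\zeta^r_{i,j}$ are i.i.d. with law $\mathcal D$. The numbers $M^r_i$ may be random and may depend on the past: for every $r$, the samples of round $r$ are independent of $(M^0,\dots,M^r)$ and the samples of rounds before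 $r$. The step size is $$\eta_g=\min\Big\{\frac1{4bL},\frac{\varepsilon}{8\sigma^2L}\Big\}\qquad\Big(\tfrac{\varepsilon}{8\sigma^2L}=+\infty\text{ if }\sigma=0\Big).$$ In the computation tree of the method every stochastic gradient $\nabla f(z^r_{i,j};\zeta^r_{i,j})$, $j<M^r_i$, is used twice: for the local step that produces $z^r_{i,j+1}$, and for one step of the following sequence. **Theorem.** Let $x^0=w^0$ and, for all $r$, $i$ and $0\le j<M^r_i$, $$x^{k+1}=x^k-\eta_g\nabla f(z^r_{i,j};\zeta^r_{i,j}),\qquad k=rb+M^r_1+\dots+M^r_{i-1}+j .$$ Then $x^{rb}=w^r$ for all $r$, and $\{x^k\}$ is a main branch of the computation tree of the method. With its auxiliary sequence $(\gamma_k,z^k,\xi^k)$, given by $z^k=z^r_{i,j}$ and $\xi^k=\zeta^r_{i,j}$ for the above $k$, it satisfies the following conditions with $R=b-1$: 1. for every $k$, $\xi^k$ is independent of $\{(x^{i+1},z^{i+1},\xi^i)\}_{i=0}^{k-1}$; 2. $\mathrm{repr}(z^k)\subseteq\mathrm{repr}(x^k)$ for every $k$; 3. $\mathrm{dist}(x^k,z^k)\le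 R$ for every $k$; 4. $\gamma_k=\eta_g\le\min\{\frac1{2L},\frac1{4RL},\frac{\varepsilon}{8\sigma^2L}\}$ for every $k$ (a fraction with denominator $0$ is $+\infty$), and every other step size $\gamma$ in the tree satisfies $0\le\gamma\le\sqrt{\frac{R}{(j+1)(\log R+1)}}\,\eta_g$ with $j=\mathrm{dist}(y,\{x^k\})$, where $y$ is the node at which the step is applied (the bound is $0$ if $R=0$). Moreover, each $\|\nabla f(x^k)\|^2$ is integrable, and $$\frac1K\sum_{k=0}^{K-1}\mathbb E\|\nabla f(x^k)\|^2\le\varepsilon\qquad\text{for all integers } K\ge\frac{8bL\Delta}{\varepsilon}+\frac{16\sigma^2L\Delta}{\varepsilon^2}.$$ -/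

import Mathlib

open MeasureTheory ProbabilityTheory

namespace BirchSGD

/-! ### Assumptions on the objective and on the stochastic gradients -/

/-- `f` is differentiable with an `L`-Lipschitz gradient. -/
structure IsSmooth {d : ℕ} (f : EuclideanSpace ℝ (Fin d) → ℝ) (L : ℝ) : Prop where
  differentiable : Differentiable ℝ f
  lipschitz : ∀ x y, ‖gradient f x - gradient f y‖ ≤ L * ‖x - y‖

/-- `G x s` (written `∇f(x; s)` on paper), with `s` drawn from `D`, is an unbiased stochastic
gradient of `f` at `x` whose variance is at most `σ ^ 2`, for every `x`. -/
structure IsStochasticGradient {d : ℕ} {S : Type*} [MeasurableSpace S]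
    (f : EuclideanSpace ℝ (Fin d) → ℝ)
    (G : EuclideanSpace ℝ (Fin d) → S → EuclideanSpace ℝ (Fin d))
    (D : Measure S) (σ : ℝ) : Prop where
  measurable : Measurable (Function.uncurry G)
  integrable : ∀ x, Integrable (G x) D
  unbiased : ∀ x, ∫ s, G x s ∂D = gradient f x
  integrable_sq : ∀ x, Integrable (fun s => ‖G x s - gradient f x‖ ^ 2) D
  variance_le : ∀ x, ∫ s, ‖G x s - gradient f x‖ ^ 2 ∂D ≤ σ ^ 2

/-! ### Computation trees -/

/-- A computation tree. The nodes are the natural numbers: node `0` is the root `w⁰`, and node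
`k + 1` is the point computed in iteration `k`, namely
`w^{k+1} = w_base - γ ∇f(w_grad; ζ)`, where `base k` and `grad k` are the (already computed) nodes
`w_base` and `w_grad`, `step k` is `γ`, and `label k` is the name of the random sample `ζ`
(samples may be reused, so two iterations may carry the same name).
Iteration `k` adds the edge from `base k` to `k + 1`. -/
structure ComputationTree (I : Type*) where
  base : ℕ → ℕ
  grad : ℕ → ℕ
  step : ℕ → ℝ
  label : ℕ → I
  base_le : ∀ k, base k ≤ k
  grad_le : ∀ k, grad k ≤ k

namespace ComputationTree

variable {I : Type*}

/-- The vector sitting at a node, given the starting point, the stochastic gradients and the values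
of the samples. -/
noncomputable def point {E S : Type*} [AddCommGroup E] [Module ℝ E] (T : ComputationTree I)
    (w₀ : E) (G : E → S → E) (s : I → S) : ℕ → E
  | 0 => w₀
  | k + 1 =>
      have := T.base_le k
      have := T.grad_le k
      point T w₀ G s (T.base k) - T.step k • G (point T w₀ G s (T.grad k)) (s (T.label k))

/-- The number of edges between the root and a node. -/
def depth (T : ComputationTree I) : ℕ → ℕ
  | 0 => 0
  | k + 1 =>
      have := T.base_le k
      depth T (T.base k) + 1

/-- The ancestors of a node, including the node itself. -/
def ancestors (T : ComputationTree I) : ℕ → Finset ℕ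
  | 0 => {0}
  | k + 1 =>
      have := T.base_le k
      insert (k + 1) (ancestors T (T.base k))

/-- The depth of the closest (that is, deepest) common ancestor of `y` and `z`. -/
def commonDepth (T : ComputationTree I) (y z : ℕ) : ℕ :=
  (T.ancestors y ∩ T.ancestors z).sup T.depth

/-- The tree distance: the maximal number of edges separating `y` and `z` from their closest common
ancestor. -/
def dist (T : ComputationTree I) (y z : ℕ) : ℕ :=
  max (T.depth y - T.commonDepth y z) (T.depth z - T.commonDepth y z)

/-- The distance from a node to a sequence of nodes, `min_k dist(y, x^k)`. -/
noncomputable def distBranch (T : ComputationTree I) (y : ℕ) (x : ℕ → ℕ) : ℕ :=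
  ⨅ k, T.dist y (x k)

/-- The representation of a node: the multiset of stochastic gradients, each given by the node at
which it is evaluated and the name of its sample, applied to the root to reach the node. -/
def repr (T : ComputationTree I) : ℕ → Multiset (ℕ × I)
  | 0 => 0
  | k + 1 =>
      have := T.base_le k
      (T.grad k, T.label k) ::ₘ repr T (T.base k)

/-- The nodes `x` form a main branch, that is, an infinite path starting at the root, with auxiliary
sequence `(γ, z, ξ)`: iteration `e` below is the one that computes `x (k + 1)` from `x k`. -/
def IsMainBranch (T : ComputationTree I) (x : ℕ → ℕ) (γ : ℕ → ℝ) (z : ℕ → ℕ) (ξ : ℕ → I) : Prop :=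
  x 0 = 0 ∧ ∀ k, ∃ e, x (k + 1) = e + 1 ∧ T.base e = x k ∧
    T.step e = γ k ∧ 0 < γ k ∧ T.grad e = z k ∧ T.label e = ξ k

end ComputationTree

/-- The conditions of the main theorem on a (random) computation tree `T` with samples `ζ`, a main
branch `x`, its auxiliary sequence `(γ, z, ξ)`, a constant `R` and a main step size `γg`. -/
structure MainConditions {Ω I S E : Type*} [MeasurableSpace Ω] [MeasurableSpace S]
    [AddCommGroup E] [Module ℝ E] [MeasurableSpace E]
    (μ : Measure Ω) (D : Measure S) (w₀ : E) (G : E → S → E) (ζ : I → Ω → S)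
    (T : Ω → ComputationTree I) (x : Ω → ℕ → ℕ) (γ : Ω → ℕ → ℝ) (z : Ω → ℕ → ℕ) (ξ : Ω → ℕ → I)
    (L σ ε R γg : ℝ) : Prop where
  /-- `x` is a main branch with auxiliary sequence `(γ, z, ξ)`, and `ξ^k` has law `D`. -/
  branch : ∀ ω, (T ω).IsMainBranch (x ω) (γ ω) (z ω) (ξ ω)
  law : ∀ k, Measurable (fun ω => ζ (ξ ω k) ω) ∧ μ.map (fun ω => ζ (ξ ω k) ω) = D
  /-- Condition 1: `ξ^k` is independent of `(x^{i+1}, z^{i+1}, ξ^i)`, `i < k`. -/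
  indep : ∀ k, IndepFun (fun ω => ζ (ξ ω k) ω)
    (fun ω (i : Fin k) =>
      ((T ω).point w₀ G (fun a => ζ a ω) (x ω (i + 1)),
       (T ω).point w₀ G (fun a => ζ a ω) (z ω (i + 1)),
       ζ (ξ ω i) ω)) μ
  /-- Condition 2: the representation of `z^k` is contained in that of `x^k`. -/
  repr_le : ∀ ω k, (T ω).repr (z ω k) ≤ (T ω).repr (x ω k)
  /-- Condition 3: `z^k` and `x^k` are at tree distance at most `R`. -/
  dist_le : ∀ ω k, ((T ω).dist (x ω k) (z ω k) : ℝ) ≤ R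
  /-- Condition 4: the steps along the main branch are all equal to `γg`, where `γg` is at most
  `1 / (2 L)`, `1 / (4 R L)` and `ε / (8 σ² L)`, and every other step, applied at a node at distance
  `j` from the main branch, is at most `√(R / ((j + 1) (log R + 1))) γg`. -/
  step_eq : ∀ ω k, γ ω k = γg
  step_le : 2 * L * γg ≤ 1 ∧ 4 * R * L * γg ≤ 1 ∧ 8 * σ ^ 2 * L * γg ≤ ε
  other_step_le : ∀ ω e, (∀ k, x ω (k + 1) ≠ e + 1) →
    0 ≤ (T ω).step e ∧
    (T ω).step e ≤
      √(R / ((((T ω).distBranch ((T ω).base e) (x ω) : ℕ) + 1) * (Real.log R + 1))) * γg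

/-! ### Decaying Local SGD, asynchronous version -/

/-- The numbers `M_i` of local steps: in round `r`, worker `i` runs `steps r i` local steps, and
every round gathers exactly `b ≥ 1` stochastic gradients. -/
structure Schedule (n b : ℕ) where
  steps : ℕ → Fin n → ℕ
  pos : 0 < b
  sum_eq : ∀ r, ∑ i, steps r i = b

/-- The step size of the local step with index `j`:
`√((b - 1) / ((j + 1) (log (b - 1) + 1))) η`. For `b = 1` it is `0`. -/
noncomputable def localStep (b : ℕ) (η : ℝ) (j : ℕ) : ℝ :=
  √(((b : ℝ) - 1) / (((j : ℝ) + 1) * (Real.log ((b : ℝ) - 1) + 1))) * η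

/-- The global step size `min {1 / (4 b L), ε / (8 σ² L)}`, where the second entry is `+∞` if
`σ = 0`. -/
noncomputable def globalStep (b : ℕ) (L σ ε : ℝ) : ℝ :=
  if σ = 0 then 1 / (4 * b * L) else min (1 / (4 * b * L)) (ε / (8 * σ ^ 2 * L))

section Algorithm

variable {n b : ℕ} {E S : Type*} [AddCommGroup E] [Module ℝ E]

/-- The local iterates of one worker in one round: `z_0 = w` and
`z_{j+1} = z_j - η_j ∇f(z_j; ζ_j)`. -/
noncomputable def localIterate (b : ℕ) (η : ℝ) (G : E → S → E) (w : E) (ζ : ℕ → S) : ℕ → E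
  | 0 => w
  | j + 1 => localIterate b η G w ζ j - localStep b η j • G (localIterate b η G w ζ j) (ζ j)

/-- The global models: `w^{r+1} = w^r - η ∑_i ∑_{j < M_i} ∇f(z^r_{i,j}; ζ^r_{i,j})`. The sample
`ζ^r_{i,j}` is `ζ (r, i, j)`. -/
noncomputable def globalModel (M : Schedule n b) (η : ℝ) (w₀ : E) (G : E → S → E)
    (ζ : ℕ × Fin n × ℕ → S) : ℕ → E
  | 0 => w₀
  | r + 1 => globalModel M η w₀ G ζ r - η • ∑ i, ∑ j ∈ Finset.range (M.steps r i),
      G (localIterate b η G (globalModel M η w₀ G ζ r) (fun l => ζ (r, i, l)) j) (ζ (r, i, j))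

/-- The local point `z^r_{i,j}` of the algorithm. -/
noncomputable def localPoint (M : Schedule n b) (η : ℝ) (w₀ : E) (G : E → S → E)
    (ζ : ℕ × Fin n × ℕ → S) (r : ℕ) (i : Fin n) (j : ℕ) : E :=
  localIterate b η G (globalModel M η w₀ G ζ r) (fun l => ζ (r, i, l)) j

/-- The name `(r, i, j)` of the `k`-th stochastic gradient when the gradients are listed round by
round, inside a round worker by worker, and for each worker by local index. -/
def Schedule.sample (M : Schedule n b) (k : ℕ) : ℕ × Fin n × ℕ :=
  let p := finSigmaFinEquiv.symm
    (Fin.cast (M.sum_eq (k / b)).symm ⟨k % b, Nat.mod_lt k M.pos⟩)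
  (k / b, p.1, (p.2 : ℕ))

/-- The explicit sequence `x^0 = w^0`, `x^{k+1} = x^k - η ∇f(z^r_{i,j}; ζ^r_{i,j})`, where the
gradients are taken in the above order. -/
noncomputable def mainSequence (M : Schedule n b) (η : ℝ) (w₀ : E) (G : E → S → E)
    (ζ : ℕ × Fin n × ℕ → S) : ℕ → E
  | 0 => w₀
  | k + 1 => mainSequence M η w₀ G ζ k -
      η • G (localPoint M η w₀ G ζ (M.sample k).1 (M.sample k).2.1 (M.sample k).2.2)
        (ζ (M.sample k))

end Algorithm

section Tree

variable {n b : ℕ}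

/-- The node at which the `k`-th stochastic gradient is evaluated. Node `2 k` of the tree is `x^k`,
and node `2 k + 1` is the local point `z^r_{i,j+1}` computed with the `k`-th stochastic gradient
`(r, i, j)`. Hence `z^r_{i,0} = w^r = x^{r b}` is node `2 (r b)`, and for `j ≥ 1` the point
`z^r_{i,j}` was computed with the gradient number `k - 1`. -/
def Schedule.gradNode (M : Schedule n b) (k : ℕ) : ℕ :=
  if (M.sample k).2.2 = 0 then 2 * ((M.sample k).1 * b) else 2 * k - 1

/-- The computation tree of the method. The `k`-th stochastic gradient is used twice: iteration
`2 k` applies it at the local point where it was evaluated, with the local step size, and iteration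
`2 k + 1` applies it at `x^k`, with the global step size. -/
noncomputable def decayingTree (M : Schedule n b) (η : ℝ) : ComputationTree (ℕ × Fin n × ℕ) where
  base e := if e % 2 = 0 then M.gradNode (e / 2) else 2 * (e / 2)
  grad e := M.gradNode (e / 2)
  step e := if e % 2 = 0 then localStep b η (M.sample (e / 2)).2.2 else η
  label e := M.sample (e / 2)
  base_le e := by
    have h : (M.sample (e / 2)).1 * b ≤ e / 2 := Nat.div_mul_le_self _ _
    unfold Schedule.gradNode
    split_ifs <;> omega
  grad_le e := by
    have h : (M.sample (e / 2)).1 * b ≤ e / 2 := Nat.div_mul_le_self _ _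
    unfold Schedule.gradNode
    split_ifs <;> omega

end Tree

end BirchSGD

open BirchSGD

/-!
The sequence `x^k` is a stochastic gradient method whose `k`-th gradient is evaluated at a perturbed
point `z^k`. Both points start the current round at `w^r`, so `x^k - z^k` is a combination
`∑_p c_p ∇f(z^p; ξ^p)` of fewer than `b` gradients of that round. The local step sizes are chosen so
that, the harmonic sum being at most `1 + log (b - 1)`, always `∑_p c_p² ≤ 2 (b - 1) η_g²`; hence
`∑_k 𝔼‖x^k - z^k‖²` is controlled by the gradients at the `z^k` and the variance, and the descent
lemma for `f` absorbs this drift because `4 b L η_g ≤ 1`.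

The index of the sample `ξ^k` is random, but it is a function of the numbers of local steps up to
the current round, which take countably many values. Conditionally on such a value the index is
deterministic, so `ξ^k` has law `D` and is independent of these numbers and of `ξ^0, …, ξ^{k-1}`.
-/

namespace BirchSGD

/-! ### Smooth functions -/

section Smooth

variable {E : Type*} [NormedAddCommGroup E] [InnerProductSpace ℝ E] [CompleteSpace E]
  {f : E → ℝ} {L : ℝ}

theorem lipschitzWith_toNNReal_gradient
    (hlip : ∀ x y, ‖gradient f x - gradient f y‖ ≤ L * ‖x - y‖) :
    LipschitzWith L.toNNReal (gradient f) :=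
  .of_dist_le_mul fun x y => by
    simp only [dist_eq_norm]
    exact (hlip x y).trans (by gcongr; exact Real.le_coe_toNNReal L)

theorem hasDerivAt_comp_add_smul (hf : Differentiable ℝ f) (x v : E) (t : ℝ) :
    HasDerivAt (fun t : ℝ => f (x + t • v)) (inner ℝ (gradient f (x + t • v)) v) t := by
  have hline : HasDerivAt (fun t : ℝ => x + t • v) v t := by
    simpa using ((hasDerivAt_id t).smul_const v).const_add x
  exact (hf (x + t • v)).hasGradientAt.hasFDerivAt.comp_hasDerivAt t hline

theorem le_add_inner_gradient_add_sq (hf : Differentiable ℝ f)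
    (hlip : ∀ x y, ‖gradient f x - gradient f y‖ ≤ L * ‖x - y‖) (x y : E) :
    f y ≤ f x + inner ℝ (gradient f x) (y - x) + L / 2 * ‖y - x‖ ^ 2 := by
  obtain ⟨v, rfl⟩ : ∃ v, y = x + v := ⟨y - x, by abel⟩
  rw [add_sub_cancel_left]
  let gap : ℝ → ℝ := fun t =>
    f (x + t • v) - t * inner ℝ (gradient f x) v - L / 2 * ‖v‖ ^ 2 * t ^ 2
  have hderiv (t : ℝ) : HasDerivAt gap
      (inner ℝ (gradient f (x + t • v) - gradient f x) v - L * ‖v‖ ^ 2 * t) t := by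
    have := ((hasDerivAt_comp_add_smul hf x v t).sub
      ((hasDerivAt_id t).mul_const (inner ℝ (gradient f x) v))).sub
      ((hasDerivAt_pow 2 t).const_mul (L / 2 * ‖v‖ ^ 2))
    refine this.congr_deriv ?_
    rw [inner_sub_left]
    push_cast
    ring
  have hanti : AntitoneOn gap (Set.Icc 0 1) := by
    refine antitoneOn_of_deriv_nonpos (convex_Icc 0 1)
      (fun t _ => (hderiv t).continuousAt.continuousWithinAt)
      (fun t _ => (hderiv t).differentiableAt.differentiableWithinAt) fun t ht => ?_
    rw [interior_Icc] at ht
    have hgrad : ‖gradient f (x + t • v) - gradient f x‖ ≤ L * (t * ‖v‖) := by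
      simpa [norm_smul, abs_of_pos ht.1] using hlip (x + t • v) x
    rw [(hderiv t).deriv, sub_nonpos]
    calc inner ℝ (gradient f (x + t • v) - gradient f x) v
        ≤ ‖gradient f (x + t • v) - gradient f x‖ * ‖v‖ := real_inner_le_norm _ _
      _ ≤ L * (t * ‖v‖) * ‖v‖ := by gcongr
      _ = L * ‖v‖ ^ 2 * t := by ring
  have hends : gap 1 ≤ gap 0 :=
    hanti (Set.left_mem_Icc.2 zero_le_one) (Set.right_mem_Icc.2 zero_le_one) zero_le_one
  simp only [gap, one_smul, zero_smul, add_zero] at hends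
  linarith

end Smooth

/-! ### Square-integrable random vectors -/

section SquareIntegrable

variable {Ω E F : Type*} [MeasurableSpace Ω] {μ : Measure Ω}
  [NormedAddCommGroup E]

theorem memLp_comp_of_lipschitzWith [IsFiniteMeasure μ] [NormedAddCommGroup F] {g : E → F}
    {C : NNReal} (hg : LipschitzWith C g) {p : ENNReal} {x : Ω → E} (hx : MemLp x p μ) :
    MemLp (fun ω => g (x ω)) p μ := by
  have hcentered : MemLp ((fun v => g v - g 0) ∘ x) p μ :=
    LipschitzWith.comp_memLp (g := fun v => g v - g 0)
      (.of_dist_le_mul fun v w => by simpa [dist_eq_norm] using hg.dist_le_mul v w)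
      (sub_self _) hx
  exact (hcentered.add (memLp_const (g 0))).ae_eq (ae_of_all _ fun ω => by simp)

variable [InnerProductSpace ℝ E]

theorem integrable_inner_of_memLp_two {u v : Ω → E} (hu : MemLp u 2 μ) (hv : MemLp v 2 μ) :
    Integrable (fun ω => inner ℝ (u ω) (v ω)) μ :=
  (hu.norm.integrable_mul hv.norm).mono' (hu.1.inner hv.1)
    (ae_of_all _ fun ω => norm_inner_le_norm (u ω) (v ω))

theorem integral_norm_sum_sq_of_pairwise {ι : Type*} (s : Finset ι) {V : ι → Ω → E}
    (hV : ∀ i ∈ s, MemLp (V i) 2 μ)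
    (horth : (s : Set ι).Pairwise fun i j => ∫ ω, inner ℝ (V i ω) (V j ω) ∂μ = 0) :
    ∫ ω, ‖∑ i ∈ s, V i ω‖ ^ 2 ∂μ = ∑ i ∈ s, ∫ ω, ‖V i ω‖ ^ 2 ∂μ := by
  have hint (i) (hi : i ∈ s) (j) (hj : j ∈ s) : Integrable (fun ω => inner ℝ (V i ω) (V j ω)) μ :=
    integrable_inner_of_memLp_two (hV i hi) (hV j hj)
  simp_rw [← real_inner_self_eq_norm_sq, sum_inner, inner_sum]
  rw [integral_finsetSum _ fun i hi => integrable_finsetSum _ (hint i hi)]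
  refine Finset.sum_congr rfl fun i hi => ?_
  rw [integral_finsetSum _ (hint i hi)]
  exact Finset.sum_eq_single_of_mem i hi fun j hj hji => horth hi hj hji.symm

end SquareIntegrable

/-! ### Integrals against an independent variable -/

section Independent

variable {Ω α S F : Type*} [MeasurableSpace Ω] [MeasurableSpace α] [MeasurableSpace S]
  {μ : Measure Ω} [IsFiniteMeasure μ] [NormedAddCommGroup F] {Y : Ω → α} {ξ : Ω → S}
  {Φ : α → S → F}

theorem integrable_of_indepFun (hY : Measurable Y) (hξ : Measurable ξ) (hindep : IndepFun Y ξ μ)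
    (hΦ : StronglyMeasurable (Function.uncurry Φ)) (hsection : ∀ y, Integrable (Φ y) (μ.map ξ))
    (hnorm : Integrable (fun ω => ∫ s, ‖Φ (Y ω) s‖ ∂μ.map ξ) μ) :
    Integrable (fun ω => Φ (Y ω) (ξ ω)) μ := by
  have hpair : μ.map (fun ω => (Y ω, ξ ω)) = (μ.map Y).prod (μ.map ξ) :=
    (indepFun_iff_map_prod_eq_prod_map_map hY.aemeasurable hξ.aemeasurable).1 hindep
  have hprod : Integrable (Function.uncurry Φ) ((μ.map Y).prod (μ.map ξ)) := by
    refine (integrable_prod_iff hΦ.aestronglyMeasurable).2 ⟨ae_of_all _ hsection, ?_⟩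
    exact (integrable_map_measure hΦ.norm.integral_prod_right'.aestronglyMeasurable
      hY.aemeasurable).2 hnorm
  rw [← hpair] at hprod
  exact (integrable_map_measure hΦ.aestronglyMeasurable (hY.prodMk hξ).aemeasurable).1 hprod

theorem integral_of_indepFun [NormedSpace ℝ F] (hY : Measurable Y) (hξ : Measurable ξ)
    (hindep : IndepFun Y ξ μ) (hΦ : StronglyMeasurable (Function.uncurry Φ))
    (hint : Integrable (fun ω => Φ (Y ω) (ξ ω)) μ) :
    ∫ ω, Φ (Y ω) (ξ ω) ∂μ = ∫ ω, ∫ s, Φ (Y ω) s ∂μ.map ξ ∂μ := by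
  have hpair : μ.map (fun ω => (Y ω, ξ ω)) = (μ.map Y).prod (μ.map ξ) :=
    (indepFun_iff_map_prod_eq_prod_map_map hY.aemeasurable hξ.aemeasurable).1 hindep
  have hprod : Integrable (Function.uncurry Φ) ((μ.map Y).prod (μ.map ξ)) := by
    rw [← hpair]
    exact (integrable_map_measure hΦ.aestronglyMeasurable (hY.prodMk hξ).aemeasurable).2 hint
  calc ∫ ω, Φ (Y ω) (ξ ω) ∂μ
      = ∫ p, Function.uncurry Φ p ∂(μ.map Y).prod (μ.map ξ) := by
        rw [← hpair, integral_map (hY.prodMk hξ).aemeasurable hΦ.aestronglyMeasurable]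
        rfl
    _ = ∫ y, ∫ s, Φ y s ∂μ.map ξ ∂μ.map Y := integral_prod _ hprod
    _ = _ := integral_map hY.aemeasurable hΦ.integral_prod_right'.aestronglyMeasurable

end Independent

/-! ### One inexact gradient step -/

section GradientStep

variable {Ω E : Type*} [MeasurableSpace Ω] {μ : Measure Ω} [IsFiniteMeasure μ]
  [NormedAddCommGroup E] [InnerProductSpace ℝ E] [CompleteSpace E] {f : E → ℝ} {L : ℝ}

theorem integrable_comp_of_memLp_two (hf : Differentiable ℝ f)
    (hlip : ∀ x y, ‖gradient f x - gradient f y‖ ≤ L * ‖x - y‖) (hbdd : BddBelow (Set.range f))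
    {x : Ω → E} (hx : MemLp x 2 μ) : Integrable (fun ω => f (x ω)) μ := by
  obtain ⟨m, hm⟩ := hbdd
  have hquad : Integrable
      (fun ω => f 0 + inner ℝ (gradient f 0) (x ω) + L / 2 * ‖x ω‖ ^ 2) μ :=
    ((integrable_const _).add (integrable_inner_of_memLp_two (memLp_const _) hx)).add
      ((hx.integrable_norm_pow two_ne_zero).const_mul _)
  refine integrable_of_le_of_le (hf.continuous.comp_aestronglyMeasurable hx.1)
    (ae_of_all _ fun ω => hm ⟨_, rfl⟩) (ae_of_all _ fun ω => ?_) (integrable_const m) hquad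
  simpa using le_add_inner_gradient_add_sq hf hlip 0 (x ω)

theorem le_of_inexact_gradient_step (hf : Differentiable ℝ f)
    (hlip : ∀ x y, ‖gradient f x - gradient f y‖ ≤ L * ‖x - y‖) (η : ℝ) (x c v : E) :
    f (x - η • (c + v)) ≤ f x - η / 2 * ‖gradient f x‖ ^ 2 - η * (1 - L * η) / 2 * ‖c‖ ^ 2 +
      η / 2 * ‖gradient f x - c‖ ^ 2 + L * η ^ 2 / 2 * ‖v‖ ^ 2 -
      η * inner ℝ (gradient f x - (L * η) • c) v := by
  have hstep := le_add_inner_gradient_add_sq hf hlip x (x - η • (c + v))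
  rw [sub_sub_cancel_left, norm_neg, norm_smul, mul_pow, Real.norm_eq_abs, sq_abs, inner_neg_right,
    real_inner_smul_right, inner_add_right, norm_add_sq_real] at hstep
  have hpolar := norm_sub_sq_real (gradient f x) c
  rw [inner_sub_left, real_inner_smul_left]
  linear_combination hstep - η / 2 * hpolar

theorem integral_inexact_gradient_step_le (hf : Differentiable ℝ f)
    (hlip : ∀ x y, ‖gradient f x - gradient f y‖ ≤ L * ‖x - y‖) (hbdd : BddBelow (Set.range f))
    (η : ℝ) {x c v : Ω → E} (hx : MemLp x 2 μ) (hc : MemLp c 2 μ) (hv : MemLp v 2 μ)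
    (horth : ∫ ω, inner ℝ (gradient f (x ω) - (L * η) • c ω) (v ω) ∂μ = 0) :
    ∫ ω, f (x ω - η • (c ω + v ω)) ∂μ ≤
      ∫ ω, f (x ω) ∂μ - η / 2 * ∫ ω, ‖gradient f (x ω)‖ ^ 2 ∂μ -
        η * (1 - L * η) / 2 * ∫ ω, ‖c ω‖ ^ 2 ∂μ + η / 2 * ∫ ω, ‖gradient f (x ω) - c ω‖ ^ 2 ∂μ +
        L * η ^ 2 / 2 * ∫ ω, ‖v ω‖ ^ 2 ∂μ := by
  have hgrad : MemLp (fun ω => gradient f (x ω)) 2 μ :=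
    memLp_comp_of_lipschitzWith (lipschitzWith_toNNReal_gradient hlip) hx
  have hvalue := integrable_comp_of_memLp_two hf hlip hbdd hx
  have hgrad_sq := (hgrad.integrable_norm_pow two_ne_zero).const_mul (η / 2)
  have hc_sq := (hc.integrable_norm_pow two_ne_zero).const_mul (η * (1 - L * η) / 2)
  have hdiff_sq := ((hgrad.sub hc).integrable_norm_pow two_ne_zero).const_mul (η / 2)
  have hv_sq := (hv.integrable_norm_pow two_ne_zero).const_mul (L * η ^ 2 / 2)
  have hcross := (integrable_inner_of_memLp_two (hgrad.sub (hc.const_smul (L * η))) hv).const_mul η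
  refine (integral_mono
    (integrable_comp_of_memLp_two hf hlip hbdd (hx.sub ((hc.add hv).const_smul η)))
    (((((hvalue.sub hgrad_sq).sub hc_sq).add hdiff_sq).add hv_sq).sub hcross)
    fun ω => le_of_inexact_gradient_step hf hlip η (x ω) (c ω) (v ω)).trans_eq ?_
  rw [integral_sub' ((((hvalue.sub hgrad_sq).sub hc_sq).add hdiff_sq).add hv_sq) hcross,
    integral_add' (((hvalue.sub hgrad_sq).sub hc_sq).add hdiff_sq) hv_sq,
    integral_add' ((hvalue.sub hgrad_sq).sub hc_sq) hdiff_sq,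
    integral_sub' (hvalue.sub hgrad_sq) hc_sq, integral_sub' hvalue hgrad_sq]
  simp only [integral_const_mul, Pi.sub_apply, Pi.smul_apply, horth, mul_zero, sub_zero]

end GradientStep

/-! ### The noise of a stochastic gradient -/

section Noise

variable {d : ℕ} {Ω S : Type*} [MeasurableSpace Ω] [MeasurableSpace S] {μ : Measure Ω}
  [IsFiniteMeasure μ] {D : Measure S} {f : EuclideanSpace ℝ (Fin d) → ℝ}
  {G : EuclideanSpace ℝ (Fin d) → S → EuclideanSpace ℝ (Fin d)} {L σ : ℝ}
  {ξ : Ω → S} {z : Ω → EuclideanSpace ℝ (Fin d)}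

/-- The error `∇f(x; s) - ∇f(x)` of the stochastic gradient. -/
noncomputable def gradientNoise (f : EuclideanSpace ℝ (Fin d) → ℝ)
    (G : EuclideanSpace ℝ (Fin d) → S → EuclideanSpace ℝ (Fin d))
    (x : EuclideanSpace ℝ (Fin d)) (s : S) : EuclideanSpace ℝ (Fin d) :=
  G x s - gradient f x

theorem measurable_gradientNoise (hf : IsSmooth f L) (hG : IsStochasticGradient f G D σ) :
    Measurable (Function.uncurry (gradientNoise f G)) :=
  hG.measurable.sub
    ((lipschitzWith_toNNReal_gradient hf.lipschitz).continuous.measurable.comp measurable_fst)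

theorem integral_inner_gradientNoise [IsProbabilityMeasure D] (hG : IsStochasticGradient f G D σ)
    (u x : EuclideanSpace ℝ (Fin d)) : ∫ s, inner ℝ u (gradientNoise f G x s) ∂D = 0 := by
  have hmean : ∫ s, gradientNoise f G x s ∂D = 0 := by
    simp only [gradientNoise]
    rw [integral_sub (hG.integrable x) (integrable_const _), hG.unbiased, integral_const,
      probReal_univ, one_smul, sub_self]
  exact (integral_inner ((hG.integrable x).sub (integrable_const _)) u).trans
    (hmean.symm ▸ inner_zero_right u)

theorem integral_norm_smul_gradientNoise_sq_le (hG : IsStochasticGradient f G D σ) (c : ℝ)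
    (x : EuclideanSpace ℝ (Fin d)) :
    ∫ s, ‖c • gradientNoise f G x s‖ ^ 2 ∂D ≤ σ ^ 2 * c ^ 2 := by
  simp only [norm_smul, mul_pow, Real.norm_eq_abs, sq_abs, integral_const_mul]
  rw [mul_comm]
  exact mul_le_mul_of_nonneg_right (hG.variance_le x) (sq_nonneg c)

theorem integrable_norm_smul_gradientNoise_sq (hG : IsStochasticGradient f G D σ) (c : ℝ)
    (x : EuclideanSpace ℝ (Fin d)) : Integrable (fun s => ‖c • gradientNoise f G x s‖ ^ 2) D := by
  simp only [norm_smul, mul_pow]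
  exact (hG.integrable_sq x).const_mul _

theorem integral_inner_gradientNoise_of_indepFun [IsProbabilityMeasure D] (hf : IsSmooth f L)
    (hG : IsStochasticGradient f G D σ) (hξ : Measurable ξ) (hlaw : μ.map ξ = D)
    {u : Ω → EuclideanSpace ℝ (Fin d)} (hu : Measurable u) (hz : Measurable z)
    (hindep : IndepFun (fun ω => (u ω, z ω)) ξ μ)
    (hint : Integrable (fun ω => inner ℝ (u ω) (gradientNoise f G (z ω) (ξ ω))) μ) :
    ∫ ω, inner ℝ (u ω) (gradientNoise f G (z ω) (ξ ω)) ∂μ = 0 := by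
  have hnoise := measurable_gradientNoise hf hG
  refine (integral_of_indepFun
    (Φ := fun (p : EuclideanSpace ℝ (Fin d) × EuclideanSpace ℝ (Fin d)) s =>
      inner ℝ p.1 (gradientNoise f G p.2 s)) (hu.prodMk hz) hξ hindep ?_ hint).trans ?_
  · exact ((measurable_fst.comp measurable_fst).inner (hnoise.comp
      ((measurable_snd.comp measurable_fst).prodMk measurable_snd))).stronglyMeasurable
  · simp [hlaw, integral_inner_gradientNoise hG]

theorem stronglyMeasurable_norm_smul_gradientNoise_sq (hf : IsSmooth f L)
    (hG : IsStochasticGradient f G D σ) :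
    StronglyMeasurable (Function.uncurry fun (p : ℝ × EuclideanSpace ℝ (Fin d)) s =>
      ‖p.1 • gradientNoise f G p.2 s‖ ^ 2) :=
  (((measurable_fst.comp measurable_fst).smul ((measurable_gradientNoise hf hG).comp
    ((measurable_snd.comp measurable_fst).prodMk measurable_snd))).norm.pow_const
      2).stronglyMeasurable

theorem memLp_smul_gradientNoise (hf : IsSmooth f L) (hG : IsStochasticGradient f G D σ)
    (hξ : Measurable ξ) (hlaw : μ.map ξ = D) {c : Ω → ℝ} (hc : Measurable c) (hz : Measurable z)
    (hindep : IndepFun (fun ω => (c ω, z ω)) ξ μ) (hc_sq : Integrable (fun ω => c ω ^ 2) μ) :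
    MemLp (fun ω => c ω • gradientNoise f G (z ω) (ξ ω)) 2 μ := by
  subst hlaw
  have hmeas : Measurable (fun ω => c ω • gradientNoise f G (z ω) (ξ ω)) :=
    hc.smul ((measurable_gradientNoise hf hG).comp (hz.prodMk hξ))
  let Φ : ℝ × EuclideanSpace ℝ (Fin d) → S → ℝ := fun p s => ‖p.1 • gradientNoise f G p.2 s‖ ^ 2
  have hΦ : StronglyMeasurable (Function.uncurry Φ) :=
    stronglyMeasurable_norm_smul_gradientNoise_sq hf hG
  have hsection_meas : StronglyMeasurable fun ω => ∫ s, ‖Φ (c ω, z ω) s‖ ∂μ.map ξ :=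
    hΦ.norm.integral_prod_right'.comp_measurable (hc.prodMk hz)
  have hsections : Integrable (fun ω => ∫ s, ‖Φ (c ω, z ω) s‖ ∂μ.map ξ) μ := by
    refine (hc_sq.const_mul (σ ^ 2)).mono' hsection_meas.aestronglyMeasurable
      (ae_of_all _ fun ω => ?_)
    simp only [Φ, norm_pow, norm_norm]
    rw [Real.norm_of_nonneg (integral_nonneg fun _ => sq_nonneg _)]
    exact integral_norm_smul_gradientNoise_sq_le hG (c ω) (z ω)
  have hint : Integrable (fun ω => Φ (c ω, z ω) (ξ ω)) μ :=
    integrable_of_indepFun (hc.prodMk hz) hξ hindep hΦ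
      (fun p => integrable_norm_smul_gradientNoise_sq hG p.1 p.2) hsections
  exact (memLp_two_iff_integrable_sq_norm hmeas.aestronglyMeasurable).2 hint

theorem integral_norm_smul_gradientNoise_sq_le_of_indepFun (hf : IsSmooth f L)
    (hG : IsStochasticGradient f G D σ) (hξ : Measurable ξ) (hlaw : μ.map ξ = D) {c : Ω → ℝ}
    (hc : Measurable c) (hz : Measurable z) (hindep : IndepFun (fun ω => (c ω, z ω)) ξ μ)
    (hc_sq : Integrable (fun ω => c ω ^ 2) μ) :
    ∫ ω, ‖c ω • gradientNoise f G (z ω) (ξ ω)‖ ^ 2 ∂μ ≤ σ ^ 2 * ∫ ω, c ω ^ 2 ∂μ := by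
  have hmemLp := memLp_smul_gradientNoise hf hG hξ hlaw hc hz hindep hc_sq
  subst hlaw
  rw [integral_of_indepFun (hc.prodMk hz) hξ hindep
    (stronglyMeasurable_norm_smul_gradientNoise_sq hf hG) (hmemLp.integrable_norm_pow two_ne_zero),
    ← integral_const_mul]
  exact integral_mono_of_nonneg (ae_of_all _ fun _ => integral_nonneg fun _ => sq_nonneg _)
    (hc_sq.const_mul _) (ae_of_all _ fun ω => integral_norm_smul_gradientNoise_sq_le hG _ _)

end Noise

/-! ### Stochastic gradient descent with perturbed evaluation points -/

theorem norm_sum_smul_sq_le {ι E : Type*} [SeminormedAddCommGroup E] [NormedSpace ℝ E]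
    (s : Finset ι) (c : ι → ℝ) (v : ι → E) :
    ‖∑ i ∈ s, c i • v i‖ ^ 2 ≤ (∑ i ∈ s, c i ^ 2) * ∑ i ∈ s, ‖v i‖ ^ 2 :=
  calc ‖∑ i ∈ s, c i • v i‖ ^ 2
      ≤ (∑ i ∈ s, |c i| * ‖v i‖) ^ 2 := by
        gcongr
        exact norm_sum_le_of_le s fun i _ => (norm_smul (c i) (v i)).le
    _ ≤ (∑ i ∈ s, |c i| ^ 2) * ∑ i ∈ s, ‖v i‖ ^ 2 := Finset.sum_mul_sq_le_sq_mul_sq _ _ _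
    _ = (∑ i ∈ s, c i ^ 2) * ∑ i ∈ s, ‖v i‖ ^ 2 := by simp only [sq_abs]

theorem sum_sum_Ico_le_of_le_add {s : ℕ → ℕ} {R : ℕ} (hs : ∀ k, k ≤ s k + R) {C : ℕ → ℝ}
    (hC : ∀ p, 0 ≤ C p) (K : ℕ) :
    ∑ k ∈ Finset.range K, ∑ p ∈ Finset.Ico (s k) k, C p ≤ R * ∑ p ∈ Finset.range K, C p := by
  rw [Finset.sum_comm' (t' := Finset.range K)
    (s' := fun p => {k ∈ Finset.range K | p ∈ Finset.Ico (s k) k})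
    (fun k p => by simp only [Finset.mem_range, Finset.mem_Ico, Finset.mem_filter]; omega),
    Finset.mul_sum]
  gcongr with p
  have hcard : ({k ∈ Finset.range K | p ∈ Finset.Ico (s k) k} : Finset ℕ).card ≤ R := by
    refine (Finset.card_le_card (t := Finset.Ioc p (p + R)) fun k hk => ?_).trans (by simp)
    have := hs k
    simp only [Finset.mem_filter, Finset.mem_Ico, Finset.mem_Ioc] at hk ⊢
    omega
  rw [Finset.sum_const, nsmul_eq_mul]
  exact mul_le_mul_of_nonneg_right (Nat.cast_le.2 hcard) (hC p)

/-- Stochastic gradient descent `X (k + 1) = X k - η ∇f(Z k; ξ k)` whose gradients are evaluated at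
points `Z k` that differ from `X k` by a random combination, with coefficients `c k p`, of the
stochastic gradients in the window `s k ≤ p < k`. The filtration `𝓕` records the past: `ξ k` is
independent of `𝓕 k`. -/
structure IsPerturbedSGD {d : ℕ} {Ω S : Type*} [mΩ : MeasurableSpace Ω] [MeasurableSpace S]
    (μ : Measure Ω) (D : Measure S)
    (G : EuclideanSpace ℝ (Fin d) → S → EuclideanSpace ℝ (Fin d)) (w₀ : EuclideanSpace ℝ (Fin d))
    (η : ℝ) (𝓕 : Filtration ℕ mΩ) (X Z : ℕ → Ω → EuclideanSpace ℝ (Fin d)) (ξ : ℕ → Ω → S)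
    (s : ℕ → ℕ) (c : ℕ → ℕ → Ω → ℝ) (B : ℝ) : Prop where
  law : ∀ k, μ.map (ξ k) = D
  indep : ∀ k, Indep (MeasurableSpace.comap (ξ k) inferInstance) (𝓕 k) μ
  measurable_sample : ∀ k, Measurable[𝓕 (k + 1)] (ξ k)
  main_zero : ∀ ω, X 0 ω = w₀
  main_succ : ∀ k ω, X (k + 1) ω = X k ω - η • G (Z k ω) (ξ k ω)
  main_sub : ∀ k ω, X k ω - Z k ω = ∑ p ∈ Finset.Ico (s k) k, c k p ω • G (Z p ω) (ξ p ω)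
  measurable_coeff : ∀ k, ∀ p ∈ Finset.Ico (s k) k, Measurable[𝓕 p] (c k p)
  sum_sq_coeff_le : ∀ k ω, ∑ p ∈ Finset.Ico (s k) k, c k p ω ^ 2 ≤ B

namespace IsPerturbedSGD

variable {d : ℕ} {Ω S : Type*} [mΩ : MeasurableSpace Ω] [MeasurableSpace S] {μ : Measure Ω}
  {D : Measure S} {f : EuclideanSpace ℝ (Fin d) → ℝ}
  {G : EuclideanSpace ℝ (Fin d) → S → EuclideanSpace ℝ (Fin d)} {L σ η : ℝ}
  {w₀ : EuclideanSpace ℝ (Fin d)} {𝓕 : Filtration ℕ mΩ}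
  {X Z : ℕ → Ω → EuclideanSpace ℝ (Fin d)} {ξ : ℕ → Ω → S} {s : ℕ → ℕ} {c : ℕ → ℕ → Ω → ℝ} {B : ℝ}

theorem main_eq (hP : IsPerturbedSGD μ D G w₀ η 𝓕 X Z ξ s c B) (k : ℕ) (ω : Ω) :
    X k ω = w₀ - ∑ p ∈ Finset.range k, η • G (Z p ω) (ξ p ω) := by
  induction k with
  | zero => simp [hP.main_zero]
  | succ k ih => rw [hP.main_succ, ih, Finset.sum_range_succ, sub_sub]

theorem eval_eq (hP : IsPerturbedSGD μ D G w₀ η 𝓕 X Z ξ s c B) (k : ℕ) :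
    Z k = fun ω => w₀ - ∑ p ∈ Finset.range k, η • G (Z p ω) (ξ p ω) -
      ∑ p ∈ Finset.Ico (s k) k, c k p ω • G (Z p ω) (ξ p ω) := by
  funext ω
  rw [← hP.main_sub, ← hP.main_eq, sub_sub_cancel]

theorem measurable_eval (hP : IsPerturbedSGD μ D G w₀ η 𝓕 X Z ξ s c B)
    (hG : Measurable (Function.uncurry G)) (k : ℕ) : Measurable[𝓕 k] (Z k) := by
  induction k using Nat.strong_induction_on with
  | _ k ih =>
    have hgrad (p : ℕ) (hp : p < k) : Measurable[𝓕 k] (fun ω => G (Z p ω) (ξ p ω)) :=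
      hG.comp (((ih p hp).mono (𝓕.mono hp.le) le_rfl).prodMk
        ((hP.measurable_sample p).mono (𝓕.mono hp) le_rfl))
    rw [hP.eval_eq]
    refine (measurable_const.sub (Finset.measurable_fun_sum _ fun p hp =>
      (hgrad p (Finset.mem_range.1 hp)).const_smul η)).sub
      (Finset.measurable_fun_sum _ fun p hp => ?_)
    have hpk := (Finset.mem_Ico.1 hp).2
    exact ((hP.measurable_coeff k p hp).mono (𝓕.mono hpk.le) le_rfl).fun_smul (hgrad p hpk)

theorem measurable_eval_sample (hP : IsPerturbedSGD μ D G w₀ η 𝓕 X Z ξ s c B)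
    (hG : Measurable (Function.uncurry G)) {p k : ℕ} (hpk : p < k) :
    Measurable[𝓕 k] (fun ω => (Z p ω, ξ p ω)) :=
  ((hP.measurable_eval hG p).mono (𝓕.mono hpk.le) le_rfl).prodMk
    ((hP.measurable_sample p).mono (𝓕.mono hpk) le_rfl)

theorem measurable_main (hP : IsPerturbedSGD μ D G w₀ η 𝓕 X Z ξ s c B)
    (hG : Measurable (Function.uncurry G)) (k : ℕ) : Measurable[𝓕 k] (X k) := by
  rw [show X k = _ from funext (hP.main_eq k)]
  exact measurable_const.sub (Finset.measurable_fun_sum _ fun p hp =>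
    (hG.comp (hP.measurable_eval_sample hG (Finset.mem_range.1 hp))).const_smul η)

theorem indepFun_sample (hP : IsPerturbedSGD μ D G w₀ η 𝓕 X Z ξ s c B) {α : Type*}
    [MeasurableSpace α] {k : ℕ} {Y : Ω → α} (hY : Measurable[𝓕 k] Y) : IndepFun Y (ξ k) μ :=
  (IndepFun_iff_Indep _ _ _).2 (indep_of_indep_of_le_right (hP.indep k) hY.comap_le).symm

theorem abs_coeff_le (hP : IsPerturbedSGD μ D G w₀ η 𝓕 X Z ξ s c B) {k p : ℕ}
    (hp : p ∈ Finset.Ico (s k) k) (ω : Ω) : |c k p ω| ≤ √B :=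
  Real.abs_le_sqrt ((Finset.single_le_sum (f := fun p => c k p ω ^ 2)
    (fun _ _ => sq_nonneg _) hp).trans (hP.sum_sq_coeff_le k ω))

theorem memLp_coeff_smul (hP : IsPerturbedSGD μ D G w₀ η 𝓕 X Z ξ s c B) {k p : ℕ}
    (hp : p ∈ Finset.Ico (s k) k) {v : Ω → EuclideanSpace ℝ (Fin d)} (hv : MemLp v 2 μ) :
    MemLp (fun ω => c k p ω • v ω) 2 μ := by
  have hcoeff : Measurable (c k p) := (hP.measurable_coeff k p hp).mono (𝓕.le _) le_rfl
  refine hv.of_le_mul (c := √B) (hcoeff.aestronglyMeasurable.smul hv.1) (ae_of_all _ fun ω => ?_)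
  rw [norm_smul]
  exact mul_le_mul_of_nonneg_right (hP.abs_coeff_le hp ω) (norm_nonneg _)

variable [IsProbabilityMeasure μ]

theorem integrable_sq_coeff (hP : IsPerturbedSGD μ D G w₀ η 𝓕 X Z ξ s c B) {k p : ℕ}
    (hp : p ∈ Finset.Ico (s k) k) : Integrable (fun ω => c k p ω ^ 2) μ := by
  have hcoeff : Measurable (c k p) := (hP.measurable_coeff k p hp).mono (𝓕.le _) le_rfl
  refine (integrable_const (√B ^ 2)).mono' (hcoeff.pow_const 2).aestronglyMeasurable
    (ae_of_all _ fun ω => ?_)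
  rw [norm_pow]
  exact pow_le_pow_left₀ (norm_nonneg _) (hP.abs_coeff_le hp ω) 2

variable (hP : IsPerturbedSGD μ D G w₀ η 𝓕 X Z ξ s c B) (hf : IsSmooth f L)
  (hG : IsStochasticGradient f G D σ)

include hP hf hG

theorem memLp_smul_noise {k : ℕ} {a : Ω → ℝ} (ha : Measurable[𝓕 k] a)
    (ha_sq : Integrable (fun ω => a ω ^ 2) μ) :
    MemLp (fun ω => a ω • gradientNoise f G (Z k ω) (ξ k ω)) 2 μ :=
  memLp_smul_gradientNoise hf hG ((hP.measurable_sample k).mono (𝓕.le _) le_rfl) (hP.law k)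
    (ha.mono (𝓕.le _) le_rfl) ((hP.measurable_eval hG.measurable k).mono (𝓕.le _) le_rfl)
    (hP.indepFun_sample (ha.prodMk (hP.measurable_eval hG.measurable k))) ha_sq

theorem integral_norm_smul_noise_sq_le {k : ℕ} {a : Ω → ℝ} (ha : Measurable[𝓕 k] a)
    (ha_sq : Integrable (fun ω => a ω ^ 2) μ) :
    ∫ ω, ‖a ω • gradientNoise f G (Z k ω) (ξ k ω)‖ ^ 2 ∂μ ≤ σ ^ 2 * ∫ ω, a ω ^ 2 ∂μ :=
  integral_norm_smul_gradientNoise_sq_le_of_indepFun hf hG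
    ((hP.measurable_sample k).mono (𝓕.le _) le_rfl) (hP.law k)
    (ha.mono (𝓕.le _) le_rfl) ((hP.measurable_eval hG.measurable k).mono (𝓕.le _) le_rfl)
    (hP.indepFun_sample (ha.prodMk (hP.measurable_eval hG.measurable k))) ha_sq

theorem memLp_noise (k : ℕ) : MemLp (fun ω => gradientNoise f G (Z k ω) (ξ k ω)) 2 μ := by
  simpa using hP.memLp_smul_noise hf hG (k := k) (a := fun _ => 1) measurable_const (by simp)

theorem integral_norm_noise_sq_le (k : ℕ) :
    ∫ ω, ‖gradientNoise f G (Z k ω) (ξ k ω)‖ ^ 2 ∂μ ≤ σ ^ 2 := by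
  simpa using hP.integral_norm_smul_noise_sq_le hf hG (k := k) (a := fun _ => 1)
    measurable_const (by simp)

theorem integral_inner_noise [IsProbabilityMeasure D] {k : ℕ} {u : Ω → EuclideanSpace ℝ (Fin d)}
    (hu : Measurable[𝓕 k] u) (hu_memLp : MemLp u 2 μ) :
    ∫ ω, inner ℝ (u ω) (gradientNoise f G (Z k ω) (ξ k ω)) ∂μ = 0 :=
  integral_inner_gradientNoise_of_indepFun hf hG ((hP.measurable_sample k).mono (𝓕.le _) le_rfl)
    (hP.law k) (hu.mono (𝓕.le _) le_rfl)
    ((hP.measurable_eval hG.measurable k).mono (𝓕.le _) le_rfl)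
    (hP.indepFun_sample (hu.prodMk (hP.measurable_eval hG.measurable k)))
    (integrable_inner_of_memLp_two hu_memLp (hP.memLp_noise hf hG k))

theorem memLp_eval (k : ℕ) : MemLp (Z k) 2 μ := by
  induction k using Nat.strong_induction_on with
  | _ k ih =>
    have hgrad (p : ℕ) (hp : p < k) : MemLp (fun ω => G (Z p ω) (ξ p ω)) 2 μ :=
      ((memLp_comp_of_lipschitzWith (lipschitzWith_toNNReal_gradient hf.lipschitz) (ih p hp)).add
        (hP.memLp_noise hf hG p)).ae_eq (ae_of_all _ fun ω => add_sub_cancel _ _)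
    rw [hP.eval_eq]
    exact ((memLp_const w₀).sub (memLp_finsetSum _ fun p hp =>
      (hgrad p (Finset.mem_range.1 hp)).const_smul η)).sub
      (memLp_finsetSum _ fun p hp => hP.memLp_coeff_smul hp (hgrad p (Finset.mem_Ico.1 hp).2))

theorem memLp_gradient_eval (k : ℕ) : MemLp (fun ω => gradient f (Z k ω)) 2 μ :=
  memLp_comp_of_lipschitzWith (lipschitzWith_toNNReal_gradient hf.lipschitz)
    (hP.memLp_eval hf hG k)

theorem memLp_main (k : ℕ) : MemLp (X k) 2 μ := by
  rw [show X k = _ from funext (hP.main_eq k)]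
  exact (memLp_const w₀).sub (memLp_finsetSum _ fun p _ =>
    (((hP.memLp_gradient_eval hf hG p).add (hP.memLp_noise hf hG p)).ae_eq
      (ae_of_all _ fun ω => add_sub_cancel _ _)).const_smul η)

theorem memLp_gradient_main (k : ℕ) : MemLp (fun ω => gradient f (X k ω)) 2 μ :=
  memLp_comp_of_lipschitzWith (lipschitzWith_toNNReal_gradient hf.lipschitz)
    (hP.memLp_main hf hG k)

theorem integral_inner_smul_noise_of_lt [IsProbabilityMeasure D] {k p q : ℕ}
    (hp : p ∈ Finset.Ico (s k) k) (hq : q ∈ Finset.Ico (s k) k) (hpq : p < q) :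
    ∫ ω, inner ℝ (c k p ω • gradientNoise f G (Z p ω) (ξ p ω))
      (c k q ω • gradientNoise f G (Z q ω) (ξ q ω)) ∂μ = 0 := by
  have hnoise : Measurable[𝓕 q] (fun ω => gradientNoise f G (Z p ω) (ξ p ω)) :=
    (measurable_gradientNoise hf hG).comp (hP.measurable_eval_sample hG.measurable hpq)
  have hpast : Measurable[𝓕 q] (fun ω => c k q ω • c k p ω • gradientNoise f G (Z p ω) (ξ p ω)) :=
    (hP.measurable_coeff k q hq).fun_smul
      (((hP.measurable_coeff k p hp).mono (𝓕.mono hpq.le) le_rfl).fun_smul hnoise)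
  simp_rw [real_inner_smul_right, ← real_inner_smul_left]
  exact hP.integral_inner_noise hf hG hpast
    (hP.memLp_coeff_smul hq (hP.memLp_coeff_smul hp (hP.memLp_noise hf hG p)))

theorem integral_norm_sum_smul_noise_sq_le [IsProbabilityMeasure D] (k : ℕ) :
    ∫ ω, ‖∑ p ∈ Finset.Ico (s k) k, c k p ω • gradientNoise f G (Z p ω) (ξ p ω)‖ ^ 2 ∂μ ≤
      σ ^ 2 * B := by
  have horth : (Finset.Ico (s k) k : Set ℕ).Pairwise fun p q =>
      ∫ ω, inner ℝ (c k p ω • gradientNoise f G (Z p ω) (ξ p ω))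
        (c k q ω • gradientNoise f G (Z q ω) (ξ q ω)) ∂μ = 0 := by
    intro p hp q hq hpq
    rcases hpq.lt_or_gt with hlt | hlt
    · exact hP.integral_inner_smul_noise_of_lt hf hG hp hq hlt
    · simp_rw [real_inner_comm (c k q _ • _)]
      exact hP.integral_inner_smul_noise_of_lt hf hG hq hp hlt
  calc ∫ ω, ‖∑ p ∈ Finset.Ico (s k) k, c k p ω • gradientNoise f G (Z p ω) (ξ p ω)‖ ^ 2 ∂μ
      = ∑ p ∈ Finset.Ico (s k) k, ∫ ω, ‖c k p ω • gradientNoise f G (Z p ω) (ξ p ω)‖ ^ 2 ∂μ :=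
        integral_norm_sum_sq_of_pairwise _
          (fun p hp => hP.memLp_coeff_smul hp (hP.memLp_noise hf hG p)) horth
    _ ≤ ∑ p ∈ Finset.Ico (s k) k, σ ^ 2 * ∫ ω, c k p ω ^ 2 ∂μ :=
        Finset.sum_le_sum fun p hp => hP.integral_norm_smul_noise_sq_le hf hG
          (hP.measurable_coeff k p hp) (hP.integrable_sq_coeff hp)
    _ = σ ^ 2 * ∫ ω, ∑ p ∈ Finset.Ico (s k) k, c k p ω ^ 2 ∂μ := by
        rw [integral_finsetSum _ fun p hp => hP.integrable_sq_coeff hp, Finset.mul_sum]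
    _ ≤ σ ^ 2 * ∫ _, B ∂μ := by
        gcongr
        · exact integrable_finsetSum _ fun p hp => hP.integrable_sq_coeff hp
        · exact integrable_const B
        · exact fun ω => hP.sum_sq_coeff_le k ω
    _ = σ ^ 2 * B := by simp

theorem integral_norm_main_sub_eval_sq_le [IsProbabilityMeasure D] (k : ℕ) :
    ∫ ω, ‖X k ω - Z k ω‖ ^ 2 ∂μ ≤
      2 * B * (∑ p ∈ Finset.Ico (s k) k, ∫ ω, ‖gradient f (Z p ω)‖ ^ 2 ∂μ + σ ^ 2) := by
  have hgrad_sq (p : ℕ) : Integrable (fun ω => ‖gradient f (Z p ω)‖ ^ 2) μ :=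
    (hP.memLp_gradient_eval hf hG p).integrable_norm_pow two_ne_zero
  have hgrad_int : Integrable
      (fun ω => 2 * B * ∑ p ∈ Finset.Ico (s k) k, ‖gradient f (Z p ω)‖ ^ 2) μ :=
    (integrable_finsetSum _ fun p _ => hgrad_sq p).const_mul _
  have hnoise_int : Integrable (fun ω =>
      2 * ‖∑ p ∈ Finset.Ico (s k) k, c k p ω • gradientNoise f G (Z p ω) (ξ p ω)‖ ^ 2) μ :=
    ((memLp_finsetSum _ fun p hp => hP.memLp_coeff_smul hp
      (hP.memLp_noise hf hG p)).integrable_norm_pow two_ne_zero).const_mul 2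
  have hpointwise (ω : Ω) : ‖X k ω - Z k ω‖ ^ 2 ≤
      2 * B * ∑ p ∈ Finset.Ico (s k) k, ‖gradient f (Z p ω)‖ ^ 2 +
        2 * ‖∑ p ∈ Finset.Ico (s k) k, c k p ω • gradientNoise f G (Z p ω) (ξ p ω)‖ ^ 2 := by
    set a := ∑ p ∈ Finset.Ico (s k) k, c k p ω • gradient f (Z p ω) with ha
    set v := ∑ p ∈ Finset.Ico (s k) k, c k p ω • gradientNoise f G (Z p ω) (ξ p ω) with hv
    have hsplit : X k ω - Z k ω = a + v := by
      simp only [hP.main_sub, ha, hv, gradientNoise, smul_sub, Finset.sum_sub_distrib,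
        add_sub_cancel]
    have ha_sq : ‖a‖ ^ 2 ≤ B * ∑ p ∈ Finset.Ico (s k) k, ‖gradient f (Z p ω)‖ ^ 2 :=
      (norm_sum_smul_sq_le _ _ _).trans (by gcongr; exact hP.sum_sq_coeff_le k ω)
    rw [hsplit]
    linarith [parallelogram_law_with_norm ℝ a v, sq_nonneg ‖a - v‖]
  calc ∫ ω, ‖X k ω - Z k ω‖ ^ 2 ∂μ
      ≤ 2 * B * ∑ p ∈ Finset.Ico (s k) k, ∫ ω, ‖gradient f (Z p ω)‖ ^ 2 ∂μ +
          2 * ∫ ω, ‖∑ p ∈ Finset.Ico (s k) k,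
            c k p ω • gradientNoise f G (Z p ω) (ξ p ω)‖ ^ 2 ∂μ := by
        rw [← integral_finsetSum _ fun p _ => hgrad_sq p, ← integral_const_mul,
          ← integral_const_mul, ← integral_add hgrad_int hnoise_int]
        exact integral_mono_of_nonneg (ae_of_all _ fun _ => sq_nonneg _)
          (hgrad_int.add hnoise_int) (ae_of_all _ hpointwise)
    _ ≤ _ := by linarith [hP.integral_norm_sum_smul_noise_sq_le hf hG k]

theorem integral_main_succ_le [IsProbabilityMeasure D] (hbdd : BddBelow (Set.range f)) (hL : 0 ≤ L)
    (k : ℕ) :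
    ∫ ω, f (X (k + 1) ω) ∂μ ≤ ∫ ω, f (X k ω) ∂μ - η / 2 * ∫ ω, ‖gradient f (X k ω)‖ ^ 2 ∂μ -
      η * (1 - L * η) / 2 * ∫ ω, ‖gradient f (Z k ω)‖ ^ 2 ∂μ +
      η / 2 * ∫ ω, ‖gradient f (X k ω) - gradient f (Z k ω)‖ ^ 2 ∂μ +
      L * η ^ 2 / 2 * σ ^ 2 := by
  have hgrad_meas : Measurable (gradient f) :=
    (lipschitzWith_toNNReal_gradient hf.lipschitz).continuous.measurable
  have hpast : Measurable[𝓕 k] (fun ω => gradient f (X k ω) - (L * η) • gradient f (Z k ω)) :=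
    (hgrad_meas.comp (hP.measurable_main hG.measurable k)).sub
      ((hgrad_meas.comp (hP.measurable_eval hG.measurable k)).const_smul (L * η))
  have hstep := integral_inexact_gradient_step_le hf.differentiable hf.lipschitz hbdd η
    (hP.memLp_main hf hG k) (hP.memLp_gradient_eval hf hG k) (hP.memLp_noise hf hG k)
    (hP.integral_inner_noise hf hG hpast ((hP.memLp_gradient_main hf hG k).sub
      ((hP.memLp_gradient_eval hf hG k).const_smul (L * η))))
  simp only [gradientNoise, add_sub_cancel, ← hP.main_succ] at hstep
  have hnoise := mul_le_mul_of_nonneg_left (hP.integral_norm_noise_sq_le hf hG k)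
    (by positivity : 0 ≤ L * η ^ 2 / 2)
  simp only [gradientNoise] at hnoise
  linarith

theorem sum_descent_le [IsProbabilityMeasure D] (hbdd : BddBelow (Set.range f)) (hL : 0 ≤ L)
    (hη : 0 < η) (K : ℕ) :
    (∑ k ∈ Finset.range K, ∫ ω, ‖gradient f (X k ω)‖ ^ 2 ∂μ) +
        (1 - L * η) * ∑ k ∈ Finset.range K, ∫ ω, ‖gradient f (Z k ω)‖ ^ 2 ∂μ ≤
      2 * ((f w₀ - ⨅ x, f x) / η) +
        (∑ k ∈ Finset.range K, ∫ ω, ‖gradient f (X k ω) - gradient f (Z k ω)‖ ^ 2 ∂μ) +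
        K * (L * η * σ ^ 2) := by
  have hstart : ∫ ω, f (X 0 ω) ∂μ = f w₀ := by simp [hP.main_zero]
  have hend : ⨅ x, f x ≤ ∫ ω, f (X K ω) ∂μ := by
    simpa using integral_mono (integrable_const (⨅ x, f x))
      (integrable_comp_of_memLp_two hf.differentiable hf.lipschitz hbdd (hP.memLp_main hf hG K))
      fun ω => ciInf_le hbdd (X K ω)
  have hsum := Finset.sum_le_sum fun k (_ : k ∈ Finset.range K) =>
    hP.integral_main_succ_le hf hG hbdd hL k
  have htelescope := Finset.sum_range_sub (fun k => ∫ ω, f (X k ω) ∂μ) K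
  simp only [Finset.sum_add_distrib, Finset.sum_sub_distrib, ← Finset.mul_sum, Finset.sum_const,
    Finset.card_range, nsmul_eq_mul] at hsum htelescope
  have hη_div : η * ((f w₀ - ⨅ x, f x) / η) = f w₀ - ⨅ x, f x := mul_div_cancel₀ _ hη.ne'
  refine le_of_mul_le_mul_left ?_ (half_pos hη)
  linarith

theorem sum_integral_norm_gradient_sub_sq_le [IsProbabilityMeasure D] {R : ℕ}
    (hs : ∀ k, k ≤ s k + R) (hB : 0 ≤ B) (K : ℕ) :
    ∑ k ∈ Finset.range K, ∫ ω, ‖gradient f (X k ω) - gradient f (Z k ω)‖ ^ 2 ∂μ ≤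
      2 * L ^ 2 * B *
        (R * (∑ k ∈ Finset.range K, ∫ ω, ‖gradient f (Z k ω)‖ ^ 2 ∂μ) + K * σ ^ 2) := by
  have hstep (k : ℕ) : ∫ ω, ‖gradient f (X k ω) - gradient f (Z k ω)‖ ^ 2 ∂μ ≤ 2 * L ^ 2 * B *
      (∑ p ∈ Finset.Ico (s k) k, ∫ ω, ‖gradient f (Z p ω)‖ ^ 2 ∂μ + σ ^ 2) :=
    calc ∫ ω, ‖gradient f (X k ω) - gradient f (Z k ω)‖ ^ 2 ∂μ
        ≤ ∫ ω, L ^ 2 * ‖X k ω - Z k ω‖ ^ 2 ∂μ :=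
          integral_mono_of_nonneg (ae_of_all _ fun _ => sq_nonneg _)
            ((((hP.memLp_main hf hG k).sub (hP.memLp_eval hf hG k)).integrable_norm_pow
              two_ne_zero).const_mul _) (ae_of_all _ fun ω => by
                simpa only [mul_pow] using
                  pow_le_pow_left₀ (norm_nonneg _) (hf.lipschitz (X k ω) (Z k ω)) 2)
      _ ≤ L ^ 2 * (2 * B *
            (∑ p ∈ Finset.Ico (s k) k, ∫ ω, ‖gradient f (Z p ω)‖ ^ 2 ∂μ + σ ^ 2)) := by
          rw [integral_const_mul]
          gcongr
          exact hP.integral_norm_main_sub_eval_sq_le hf hG k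
      _ = _ := by ring
  refine (Finset.sum_le_sum fun k _ => hstep k).trans ?_
  rw [← Finset.mul_sum, Finset.sum_add_distrib, Finset.sum_const, Finset.card_range, nsmul_eq_mul]
  gcongr
  exact sum_sum_Ico_le_of_le_add hs (fun _ => integral_nonneg fun _ => sq_nonneg _) K

theorem integral_norm_gradient_main_sq_le (k : ℕ) :
    ∫ ω, ‖gradient f (X k ω)‖ ^ 2 ∂μ ≤ 2 * ∫ ω, ‖gradient f (Z k ω)‖ ^ 2 ∂μ +
      2 * ∫ ω, ‖gradient f (X k ω) - gradient f (Z k ω)‖ ^ 2 ∂μ := by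
  have hZ := ((hP.memLp_gradient_eval hf hG k).integrable_norm_pow two_ne_zero).const_mul 2
  have hdiff : Integrable (fun ω => 2 * ‖gradient f (X k ω) - gradient f (Z k ω)‖ ^ 2) μ :=
    (((hP.memLp_gradient_main hf hG k).sub
      (hP.memLp_gradient_eval hf hG k)).integrable_norm_pow two_ne_zero).const_mul 2
  rw [← integral_const_mul, ← integral_const_mul, ← integral_add hZ hdiff]
  refine integral_mono_of_nonneg (ae_of_all _ fun _ => sq_nonneg _) (hZ.fun_add hdiff)
    (ae_of_all _ fun ω => ?_)
  have hparallelogram := parallelogram_law_with_norm ℝ (gradient f (Z k ω))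
    (gradient f (X k ω) - gradient f (Z k ω))
  rw [add_sub_cancel] at hparallelogram
  linarith [sq_nonneg ‖gradient f (Z k ω) - (gradient f (X k ω) - gradient f (Z k ω))‖]

theorem sum_integral_norm_gradient_main_sq_le [IsProbabilityMeasure D] {R : ℕ}
    (hbdd : BddBelow (Set.range f)) (hL : 0 ≤ L) (hη : 0 < η) (hstep : 4 * (R + 1) * L * η ≤ 1)
    (hs : ∀ k, k ≤ s k + R) (hB : B = 2 * R * η ^ 2) (K : ℕ) :
    6 * ∑ k ∈ Finset.range K, ∫ ω, ‖gradient f (X k ω)‖ ^ 2 ∂μ ≤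
      10 * ((f w₀ - ⨅ x, f x) / η) + (5 + 28 * R * L * η) * (L * η * σ ^ 2) * K := by
  have hLη : 0 ≤ L * η := mul_nonneg hL hη.le
  have hRLη : 0 ≤ R * (L * η) := by positivity
  have hdescent := hP.sum_descent_le hf hG hbdd hL hη K
  have hdrift := hP.sum_integral_norm_gradient_sub_sq_le hf hG hs (hB ▸ by positivity) K
  have hsplit := Finset.sum_le_sum fun k (_ : k ∈ Finset.range K) =>
    hP.integral_norm_gradient_main_sq_le hf hG k
  rw [Finset.sum_add_distrib, ← Finset.mul_sum, ← Finset.mul_sum] at hsplit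
  set C := ∑ k ∈ Finset.range K, ∫ ω, ‖gradient f (Z k ω)‖ ^ 2 ∂μ
  have : 0 ≤ C := Finset.sum_nonneg fun _ _ => integral_nonneg fun _ => sq_nonneg _
  have hmain_coeff : 3 / 4 * C ≤ (1 - L * η) * C := by
    gcongr
    linarith
  have hdrift_coeff : 2 * L ^ 2 * B * (R * C) ≤ C / 4 :=
    calc 2 * L ^ 2 * B * (R * C) = (2 * (R * (L * η))) ^ 2 * C := by rw [hB]; ring
      _ ≤ (1 / 2) ^ 2 * C := by
          gcongr
          linarith
      _ = C / 4 := by ring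
  have hdrift_noise : 2 * L ^ 2 * B * (K * σ ^ 2) = 4 * R * L * η * (L * η * σ ^ 2) * K := by
    rw [hB]
    ring
  linear_combination 5 * hdescent + hsplit + 7 * hdrift + 5 * hmain_coeff + 7 * hdrift_coeff +
    7 * hdrift_noise

end IsPerturbedSGD

/-! ### The step sizes -/

section StepSize

variable {b : ℕ} {L σ ε η : ℝ}

theorem globalStep_pos (hb : 0 < b) (hL : 0 < L) (hε : 0 < ε) : 0 < globalStep b L σ ε := by
  have : (0 : ℝ) < b := Nat.cast_pos.2 hb
  unfold globalStep
  split_ifs with hσ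
  · positivity
  · exact lt_min (by positivity) (by positivity)

theorem four_mul_globalStep_le_one (hb : 0 < b) (hL : 0 < L) :
    4 * b * L * globalStep b L σ ε ≤ 1 := by
  have : (0 : ℝ) < b := Nat.cast_pos.2 hb
  have hle : globalStep b L σ ε ≤ 1 / (4 * b * L) := by
    unfold globalStep
    split_ifs
    exacts [le_rfl, min_le_left _ _]
  rwa [le_div_iff₀' (by positivity)] at hle

theorem sq_mul_globalStep_le (hL : 0 < L) (hε : 0 ≤ ε) :
    8 * σ ^ 2 * L * globalStep b L σ ε ≤ ε := by
  unfold globalStep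
  split_ifs with hσ
  · simp [hσ, hε]
  · rw [← le_div_iff₀' (by positivity)]
    exact min_le_right _ _

theorem globalStep_eq_or (hb : 0 < b) (hL : 0 < L) :
    4 * b * L * globalStep b L σ ε = 1 ∨ 8 * σ ^ 2 * L * globalStep b L σ ε = ε := by
  have : (0 : ℝ) < b := Nat.cast_pos.2 hb
  unfold globalStep
  split_ifs with hσ
  · left
    field_simp
  · rcases min_choice (1 / (4 * b * L)) (ε / (8 * σ ^ 2 * L)) with hmin | hmin <;> rw [hmin]
    · left
      field_simp
    · right
      field_simp

theorem localStep_nonneg (hη : 0 ≤ η) (j : ℕ) : 0 ≤ localStep b η j :=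
  mul_nonneg (Real.sqrt_nonneg _) hη

theorem localStep_succ_sq (R : ℕ) (η : ℝ) (j : ℕ) :
    localStep (R + 1) η j ^ 2 = R / (Real.log R + 1) * η ^ 2 * ((j : ℝ) + 1)⁻¹ := by
  have : 0 ≤ Real.log R := Real.log_natCast_nonneg R
  rw [localStep, Nat.cast_add_one, add_sub_cancel_right, mul_pow, Real.sq_sqrt (by positivity)]
  field_simp

theorem sum_localStep_succ_sq_le {R j : ℕ} (hj : j ≤ R) :
    ∑ l ∈ Finset.range j, localStep (R + 1) η l ^ 2 ≤ R * η ^ 2 := by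
  have : 0 ≤ Real.log R := Real.log_natCast_nonneg R
  have hharmonic : ∑ l ∈ Finset.range j, ((l : ℝ) + 1)⁻¹ ≤ Real.log R + 1 := by
    refine (Finset.sum_le_sum_of_subset_of_nonneg (Finset.range_mono hj)
      fun _ _ _ => by positivity).trans ?_
    simpa [harmonic, add_comm] using harmonic_le_one_add_log R
  simp_rw [localStep_succ_sq, ← Finset.mul_sum]
  calc R / (Real.log R + 1) * η ^ 2 * ∑ l ∈ Finset.range j, ((l : ℝ) + 1)⁻¹
      ≤ R / (Real.log R + 1) * η ^ 2 * (Real.log R + 1) := by gcongr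
    _ = R * η ^ 2 := by field_simp

/-- The coefficient of the `p`-th stochastic gradient in the difference between the `k`-th point of
the main sequence and the local point with local index `j` at which the `k`-th gradient is
evaluated. The worker of this point contributed the gradients `k - j ≤ p < k` to it. -/
noncomputable def driftCoeff (b : ℕ) (η : ℝ) (k j p : ℕ) : ℝ :=
  (if k - j ≤ p then localStep b η (p - (k - j)) else 0) - η

theorem sum_driftCoeff_sq_le (hη : 0 ≤ η) {s k j : ℕ} (hj : s + j ≤ k) (hk : k < s + b) :
    ∑ p ∈ Finset.Ico s k, driftCoeff b η k j p ^ 2 ≤ 2 * (b - 1 : ℕ) * η ^ 2 := by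
  obtain ⟨R, rfl⟩ : ∃ R, b = R + 1 := Nat.exists_eq_succ_of_ne_zero (by omega)
  have hterm (p : ℕ) : driftCoeff (R + 1) η k j p ^ 2 ≤
      (if k - j ≤ p then localStep (R + 1) η (p - (k - j)) ^ 2 else 0) + η ^ 2 := by
    unfold driftCoeff
    split_ifs
    · nlinarith [mul_nonneg (localStep_nonneg hη (p - (k - j)) (b := R + 1)) hη]
    · simp
  have hlocal : ∑ p ∈ Finset.Ico s k,
      (if k - j ≤ p then localStep (R + 1) η (p - (k - j)) ^ 2 else 0) ≤ R * η ^ 2 := by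
    have hfilter : {p ∈ Finset.Ico s k | k - j ≤ p} = Finset.Ico (k - j) k := by
      ext p
      simp only [Finset.mem_filter, Finset.mem_Ico]
      omega
    rw [← Finset.sum_filter, hfilter, Finset.sum_Ico_eq_sum_range]
    simp only [add_tsub_cancel_left]
    exact sum_localStep_succ_sq_le (by omega)
  have hglobal : ((k - s : ℕ) : ℝ) * η ^ 2 ≤ R * η ^ 2 := by
    gcongr
    omega
  refine (Finset.sum_le_sum fun p _ => hterm p).trans ?_
  rw [Finset.sum_add_distrib, Finset.sum_const, Nat.card_Ico, nsmul_eq_mul, Nat.add_sub_cancel]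
  linarith

theorem le_of_two_mul_mul_one_add_le {u τ T : ℝ} (hτ : 0 ≤ τ) (hτ_le : τ ≤ 1) (hu : 0 ≤ u)
    (h : 2 * u * (1 + τ) ≤ T) : u ≤ (1 / 2 - τ / 4) * T :=
  calc u = u * 1 := (mul_one u).symm
    _ ≤ u * ((1 + τ) * (1 - τ / 2)) := by
        gcongr
        nlinarith
    _ = 2 * u * (1 + τ) * (1 / 2 - τ / 4) := by ring
    _ ≤ T * (1 / 2 - τ / 4) := by
        gcongr
        linarith
    _ = (1 / 2 - τ / 4) * T := mul_comm _ _

theorem rate_bound_le {u α β T : ℝ} (hα : α ∈ Set.Icc 0 1) (hβ : β ∈ Set.Icc 0 1) (hu : 0 ≤ u)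
    (hT : 2 * u * (α + β) ≤ T) (hor : α = 1 ∨ β = 1) :
    10 * u + (5 + 7 * α) * β * T / 8 ≤ 6 * T := by
  have hT_nonneg : 0 ≤ T :=
    (mul_nonneg (mul_nonneg zero_le_two hu) (add_nonneg hα.1 hβ.1)).trans hT
  rcases hor with rfl | rfl
  · have hu_le := le_of_two_mul_mul_one_add_le hβ.1 hβ.2 hu hT
    linarith [mul_nonneg hβ.1 hT_nonneg]
  · have hu_le := le_of_two_mul_mul_one_add_le (T := T) hα.1 hα.2 hu (by rwa [add_comm 1 α])
    linarith [mul_nonneg hα.1 hT_nonneg]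

theorem le_of_globalStep_bound (hb : 0 < b) (hL : 0 < L) (hε : 0 < ε) {Δ K V : ℝ} (hΔ : 0 ≤ Δ)
    (hK : 8 * b * L * Δ / ε + 16 * σ ^ 2 * L * Δ / ε ^ 2 ≤ K) (hη : η = globalStep b L σ ε)
    (hV : 6 * V ≤ 10 * (Δ / η) + (5 + 28 * (b - 1 : ℕ) * L * η) * (L * η * σ ^ 2) * K) :
    V ≤ ε * K := by
  have hη_pos : 0 < η := hη ▸ globalStep_pos hb hL hε
  have hK_nonneg : 0 ≤ K := le_trans (by positivity) hK
  set u := Δ / η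
  set α := 4 * b * L * η with hα
  set β := 8 * σ ^ 2 * L * η / ε with hβ
  have hΔu : Δ = u * η := (div_mul_cancel₀ Δ hη_pos.ne').symm
  have hα_mem : α ∈ Set.Icc 0 1 := ⟨by positivity, hα ▸ hη ▸ four_mul_globalStep_le_one hb hL⟩
  have hβ_mem : β ∈ Set.Icc 0 1 :=
    ⟨by positivity, div_le_one_of_le₀ (hη ▸ sq_mul_globalStep_le hL hε.le) hε.le⟩
  have hor : α = 1 ∨ β = 1 := by
    rw [hα, hβ, div_eq_one_iff_eq hε.ne', hη]
    exact globalStep_eq_or hb hL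
  have hrounds : 2 * u * (α + β) ≤ ε * K := by
    calc 2 * u * (α + β) = ε * (8 * b * L * Δ / ε + 16 * σ ^ 2 * L * Δ / ε ^ 2) := by
          rw [hΔu, hα, hβ]
          field_simp
          ring
      _ ≤ ε * K := by gcongr
  have hvariance : (5 + 28 * (b - 1 : ℕ) * L * η) * (L * η * σ ^ 2) * K ≤
      (5 + 7 * α) * β * (ε * K) / 8 :=
    calc (5 + 28 * (b - 1 : ℕ) * L * η) * (L * η * σ ^ 2) * K
        ≤ (5 + 28 * b * L * η) * (L * η * σ ^ 2) * K := by gcongr; exact b.sub_le 1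
      _ = (5 + 7 * α) * β * (ε * K) / 8 := by
          rw [hα, hβ]
          field_simp
          ring
  linarith [rate_bound_le hα_mem hβ_mem (by positivity) hrounds hor]

end StepSize

/-! ### The order of the samples -/

theorem finSigmaFinEquiv_val_eq_sum_lt {n : ℕ} {m : Fin n → ℕ} (i : Fin n) (j : Fin (m i)) :
    (finSigmaFinEquiv ⟨i, j⟩ : ℕ) = ∑ l with l < i, m l + j := by
  have hinitial : ({l | l < i} : Finset (Fin n)) = Finset.univ.map (Fin.castLEEmb i.2.le) := by
    ext l
    simp only [Finset.mem_filter, Finset.mem_univ, true_and, Finset.mem_map, Fin.lt_def]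
    exact ⟨fun hl => ⟨⟨l, hl⟩, rfl⟩, by rintro ⟨a, rfl⟩; exact a.2⟩
  rw [finSigmaFinEquiv_apply, hinitial, Finset.sum_map]
  rfl

namespace Schedule

variable {n b : ℕ} (M : Schedule n b)

theorem sample_fst (k : ℕ) : (M.sample k).1 = k / b := rfl

theorem localIndex_lt_steps (k : ℕ) : (M.sample k).2.2 < M.steps (k / b) (M.sample k).2.1 :=
  (finSigmaFinEquiv.symm
    (Fin.cast (M.sum_eq (k / b)).symm ⟨k % b, Nat.mod_lt k M.pos⟩)).2.2

theorem sum_steps_add_localIndex (k : ℕ) :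
    ∑ l with l < (M.sample k).2.1, M.steps (k / b) l + (M.sample k).2.2 = k % b := by
  let p := finSigmaFinEquiv.symm
    (Fin.cast (M.sum_eq (k / b)).symm ⟨k % b, Nat.mod_lt k M.pos⟩)
  have hval := finSigmaFinEquiv_val_eq_sum_lt p.1 p.2
  rw [Sigma.eta, Equiv.apply_symm_apply] at hval
  exact hval.symm

theorem eq_of_sample (k : ℕ) :
    k = k / b * b + ∑ l with l < (M.sample k).2.1, M.steps (k / b) l + (M.sample k).2.2 := by
  rw [add_assoc, M.sum_steps_add_localIndex, Nat.div_add_mod']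

theorem sample_eq {r : ℕ} {i : Fin n} {j : ℕ} (hj : j < M.steps r i) :
    M.sample (r * b + ∑ l with l < i, M.steps r l + j) = (r, i, j) := by
  let p : (i : Fin n) × Fin (M.steps r i) := ⟨i, ⟨j, hj⟩⟩
  have hval : ((finSigmaFinEquiv p : Fin _) : ℕ) = ∑ l with l < i, M.steps r l + j :=
    finSigmaFinEquiv_val_eq_sum_lt p.1 p.2
  have hlt : ∑ l with l < i, M.steps r l + j < b :=
    hval.symm.trans_lt ((finSigmaFinEquiv p).2.trans_eq (M.sum_eq r))
  rw [add_assoc]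
  generalize hk : r * b + (∑ l with l < i, M.steps r l + j) = k
  obtain rfl : k / b = r := by
    rw [← hk, mul_comm, Nat.mul_add_div M.pos, Nat.div_eq_of_lt hlt, add_zero]
  have hmod : k % b = ∑ l with l < i, M.steps (k / b) l + j := by
    have := Nat.div_add_mod' k b
    omega
  have hcast : Fin.cast (M.sum_eq (k / b)).symm ⟨k % b, Nat.mod_lt k M.pos⟩ = finSigmaFinEquiv p :=
    Fin.ext (hmod.trans hval.symm)
  rw [sample, hcast, Equiv.symm_apply_apply]

theorem sample_sub_add {k l : ℕ} (hl : l ≤ (M.sample k).2.2) :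
    M.sample (k - (M.sample k).2.2 + l) = (k / b, (M.sample k).2.1, l) := by
  have hk := M.eq_of_sample k
  rw [← M.sample_eq (hl.trans_lt (M.localIndex_lt_steps k))]
  congr 1
  omega

theorem sample_injective : Function.Injective M.sample := by
  intro k k' h
  have hk := M.eq_of_sample k
  have hround : k / b = k' / b := congrArg Prod.fst h
  rw [h, hround, ← M.eq_of_sample k'] at hk
  exact hk

theorem sample_congr {M M' : Schedule n b} {k : ℕ} (h : M.steps (k / b) = M'.steps (k / b)) :
    M.sample k = M'.sample k := by
  have hk := M'.eq_of_sample k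
  have hlt := M'.localIndex_lt_steps k
  rw [← h] at hk hlt
  conv_lhs => rw [hk]
  exact M.sample_eq hlt

theorem round_mul_add_localIndex_le (k : ℕ) : k / b * b + (M.sample k).2.2 ≤ k := by
  have := M.eq_of_sample k
  omega

theorem sample_of_succ {k j : ℕ} (h : (M.sample (k + 1)).2.2 = j + 1) :
    M.sample k = ((k + 1) / b, (M.sample (k + 1)).2.1, j) := by
  have hsample := M.sample_sub_add (k := k + 1) (l := j) (by omega)
  have := M.round_mul_add_localIndex_le (k + 1)
  rwa [show k + 1 - (M.sample (k + 1)).2.2 + j = k by omega] at hsample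

theorem div_of_localIndex_succ {k j : ℕ} (h : (M.sample (k + 1)).2.2 = j + 1) :
    (k + 1) / b = k / b :=
  (congrArg Prod.fst (M.sample_of_succ h)).symm

theorem localIndex_of_succ {k j : ℕ} (h : (M.sample (k + 1)).2.2 = j + 1) :
    (M.sample k).2.2 = j :=
  congrArg (fun a => a.2.2) (M.sample_of_succ h)

theorem gradNode_of_zero {k : ℕ} (h : (M.sample k).2.2 = 0) : M.gradNode k = 2 * (k / b * b) := by
  simp [gradNode, h, sample_fst]

theorem gradNode_of_succ {k j : ℕ} (h : (M.sample (k + 1)).2.2 = j + 1) :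
    M.gradNode (k + 1) = 2 * k + 1 := by
  rw [gradNode, h, if_neg j.succ_ne_zero]
  omega

@[elab_as_elim]
theorem localIndex_induction {P : ℕ → Prop} (zero : ∀ k, (M.sample k).2.2 = 0 → P k)
    (succ : ∀ k j, (M.sample (k + 1)).2.2 = j + 1 → P k → P (k + 1)) (k : ℕ) : P k := by
  induction k with
  | zero => exact zero 0 (by simpa using M.round_mul_add_localIndex_le 0)
  | succ k ih =>
    rcases h : (M.sample (k + 1)).2.2 with _ | j
    · exact zero _ h
    · exact succ k j h ih

theorem sum_round {A : Type*} [AddCommMonoid A] (r : ℕ) (F : ℕ × Fin n × ℕ → A) :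
    ∑ p ∈ Finset.Ico (r * b) (r * b + b), F (M.sample p) =
      ∑ i, ∑ j ∈ Finset.range (M.steps r i), F (r, i, j) := by
  rw [Finset.sum_Ico_eq_sum_range, add_tsub_cancel_left]
  simp_rw [← Fin.sum_univ_eq_sum_range (fun j => F (r, _, j))]
  rw [← Fintype.sum_sigma' (fun i (j : Fin (M.steps r i)) => F (r, i, (j : ℕ))),
    ← Fin.sum_univ_eq_sum_range (fun v => F (M.sample (r * b + v)))]
  refine (Fintype.sum_equiv (finSigmaFinEquiv.trans (finCongr (M.sum_eq r))) _ _ ?_).symm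
  rintro ⟨i, j⟩
  have hval : ((finSigmaFinEquiv.trans (finCongr (M.sum_eq r))) ⟨i, j⟩ : ℕ) = _ :=
    finSigmaFinEquiv_val_eq_sum_lt i j
  rw [hval, ← add_assoc, M.sample_eq j.2]

end Schedule

/-! ### The main sequence and the local points -/

section Algorithm

variable {n b : ℕ} {E S : Type*} [AddCommGroup E] [Module ℝ E]

theorem localIterate_eq_sub_sum (η : ℝ) (G : E → S → E) (w : E) (ζ : ℕ → S) (j : ℕ) :
    localIterate b η G w ζ j = w - ∑ l ∈ Finset.range j,
      localStep b η l • G (localIterate b η G w ζ l) (ζ l) := by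
  induction j with
  | zero => simp [localIterate]
  | succ j ih => rw [Finset.sum_range_succ, ← sub_sub, ← ih, localIterate]

variable (M : Schedule n b) (η : ℝ) (w₀ : E) (G : E → S → E) (ζ : ℕ × Fin n × ℕ → S)

/-- The local point at which the `k`-th stochastic gradient is evaluated, that is, `z^k`. -/
noncomputable def evalPoint (k : ℕ) : E :=
  localPoint M η w₀ G ζ (M.sample k).1 (M.sample k).2.1 (M.sample k).2.2

theorem mainSequence_eq_sub_sum {s k : ℕ} (hsk : s ≤ k) :
    mainSequence M η w₀ G ζ k = mainSequence M η w₀ G ζ s -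
      η • ∑ p ∈ Finset.Ico s k, G (evalPoint M η w₀ G ζ p) (ζ (M.sample p)) := by
  induction k, hsk using Nat.le_induction with
  | base => simp
  | succ k hsk ih =>
    rw [Finset.sum_Ico_succ_top hsk, smul_add, ← sub_sub, ← ih]
    rfl

theorem mainSequence_mul (r : ℕ) :
    mainSequence M η w₀ G ζ (r * b) = globalModel M η w₀ G ζ r := by
  induction r with
  | zero => rw [zero_mul, mainSequence, globalModel]
  | succ r ih =>
    rw [add_mul, one_mul, mainSequence_eq_sub_sum M η w₀ G ζ (Nat.le_add_right (r * b) b), ih]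
    exact congrArg (fun g => _ - η • g)
      (M.sum_round r fun a => G (localPoint M η w₀ G ζ a.1 a.2.1 a.2.2) (ζ a))

theorem mainSequence_succ_of_lt {r : ℕ} {i : Fin n} {j : ℕ} (hj : j < M.steps r i) :
    mainSequence M η w₀ G ζ (r * b + ∑ l with l < i, M.steps r l + j + 1) =
      mainSequence M η w₀ G ζ (r * b + ∑ l with l < i, M.steps r l + j) -
        η • G (localPoint M η w₀ G ζ r i j) (ζ (r, i, j)) := by
  rw [mainSequence, M.sample_eq hj]

theorem evalPoint_eq_sub_sum (k : ℕ) :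
    evalPoint M η w₀ G ζ k = globalModel M η w₀ G ζ (k / b) -
      ∑ p ∈ Finset.Ico (k - (M.sample k).2.2) k, localStep b η (p - (k - (M.sample k).2.2)) •
        G (evalPoint M η w₀ G ζ p) (ζ (M.sample p)) := by
  have hle := M.round_mul_add_localIndex_le k
  have hsteps : ∀ l ∈ Finset.range (M.sample k).2.2,
      G (evalPoint M η w₀ G ζ (k - (M.sample k).2.2 + l))
        (ζ (M.sample (k - (M.sample k).2.2 + l))) =
      G (localPoint M η w₀ G ζ (k / b) (M.sample k).2.1 l) (ζ (k / b, (M.sample k).2.1, l)) :=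
    fun l hl => by rw [evalPoint, M.sample_sub_add (Finset.mem_range.1 hl).le]
  rw [Finset.sum_Ico_eq_sum_range, Nat.sub_sub_self (by omega)]
  simp only [add_tsub_cancel_left]
  rw [Finset.sum_congr rfl fun l hl => congrArg _ (hsteps l hl)]
  exact localIterate_eq_sub_sum η G _ _ _

theorem mainSequence_sub_evalPoint (k : ℕ) :
    mainSequence M η w₀ G ζ k - evalPoint M η w₀ G ζ k =
      ∑ p ∈ Finset.Ico (k / b * b) k, driftCoeff b η k (M.sample k).2.2 p •
        G (evalPoint M η w₀ G ζ p) (ζ (M.sample p)) := by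
  have hle := M.round_mul_add_localIndex_le k
  have hfilter : {p ∈ Finset.Ico (k / b * b) k | k - (M.sample k).2.2 ≤ p} =
      Finset.Ico (k - (M.sample k).2.2) k := by
    ext p
    simp only [Finset.mem_filter, Finset.mem_Ico]
    omega
  rw [mainSequence_eq_sub_sum M η w₀ G ζ (Nat.div_mul_le_self k b), mainSequence_mul,
    evalPoint_eq_sub_sum, sub_sub_sub_cancel_left]
  simp only [driftCoeff, sub_smul, ite_smul, zero_smul, Finset.sum_sub_distrib, Finset.smul_sum]
  rw [← Finset.sum_filter, hfilter]

end Algorithm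

/-! ### The computation tree -/

namespace ComputationTree

variable {I : Type*} (T : ComputationTree I)

theorem depth_succ (k : ℕ) : T.depth (k + 1) = T.depth (T.base k) + 1 := by
  rw [depth]

theorem repr_succ (k : ℕ) : T.repr (k + 1) = (T.grad k, T.label k) ::ₘ T.repr (T.base k) := by
  rw [repr]

theorem self_mem_ancestors (y : ℕ) : y ∈ T.ancestors y := by
  cases y <;> simp [ancestors]

theorem mem_ancestors_succ {y k : ℕ} (h : y ∈ T.ancestors (T.base k)) :
    y ∈ T.ancestors (k + 1) := by
  rw [ancestors]
  exact Finset.mem_insert_of_mem h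

theorem point_succ {E S : Type*} [AddCommGroup E] [Module ℝ E] (w₀ : E) (G : E → S → E)
    (s : I → S) (k : ℕ) :
    T.point w₀ G s (k + 1) = T.point w₀ G s (T.base k) -
      T.step k • G (T.point w₀ G s (T.grad k)) (s (T.label k)) := by
  rw [point]

theorem depth_le_commonDepth {a y z : ℕ} (hy : a ∈ T.ancestors y) (hz : a ∈ T.ancestors z) :
    T.depth a ≤ T.commonDepth y z :=
  Finset.le_sup (Finset.mem_inter.2 ⟨hy, hz⟩)

theorem dist_le_of_mem_ancestors {a y z : ℕ} (hy : a ∈ T.ancestors y) (hz : a ∈ T.ancestors z) :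
    T.dist y z ≤ max (T.depth y - T.depth a) (T.depth z - T.depth a) := by
  have := T.depth_le_commonDepth hy hz
  unfold dist
  omega

end ComputationTree

section Tree

variable {n b : ℕ} (M : Schedule n b) (η : ℝ)

theorem decayingTree_base_two_mul (k : ℕ) : (decayingTree M η).base (2 * k) = M.gradNode k := by
  simp [decayingTree]

theorem decayingTree_base_two_mul_add_one (k : ℕ) :
    (decayingTree M η).base (2 * k + 1) = 2 * k := by
  have hmod : (2 * k + 1) % 2 = 1 := by omega
  have hdiv : (2 * k + 1) / 2 = k := by omega
  simp [decayingTree, hmod, hdiv]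

theorem decayingTree_step_two_mul (k : ℕ) :
    (decayingTree M η).step (2 * k) = localStep b η (M.sample k).2.2 := by
  simp [decayingTree]

theorem decayingTree_step_two_mul_add_one (k : ℕ) : (decayingTree M η).step (2 * k + 1) = η := by
  have hmod : (2 * k + 1) % 2 = 1 := by omega
  simp [decayingTree, hmod]

theorem decayingTree_grad_two_mul (k : ℕ) : (decayingTree M η).grad (2 * k) = M.gradNode k := by
  simp [decayingTree]

theorem decayingTree_grad_two_mul_add_one (k : ℕ) :
    (decayingTree M η).grad (2 * k + 1) = M.gradNode k := by
  have hdiv : (2 * k + 1) / 2 = k := by omega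
  simp [decayingTree, hdiv]

theorem decayingTree_label_two_mul (k : ℕ) : (decayingTree M η).label (2 * k) = M.sample k := by
  simp [decayingTree]

theorem decayingTree_label_two_mul_add_one (k : ℕ) :
    (decayingTree M η).label (2 * k + 1) = M.sample k := by
  have hdiv : (2 * k + 1) / 2 = k := by omega
  simp [decayingTree, hdiv]

theorem decayingTree_isMainBranch (hη : 0 < η) :
    (decayingTree M η).IsMainBranch (fun k => 2 * k) (fun _ => η) (fun k => M.gradNode k)
      (fun k => M.sample k) :=
  ⟨rfl, fun k => ⟨2 * k + 1, rfl, decayingTree_base_two_mul_add_one M η k,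
    decayingTree_step_two_mul_add_one M η k, hη, decayingTree_grad_two_mul_add_one M η k,
    decayingTree_label_two_mul_add_one M η k⟩⟩

theorem decayingTree_depth_two_mul (k : ℕ) : (decayingTree M η).depth (2 * k) = k := by
  induction k with
  | zero => simp [ComputationTree.depth]
  | succ k ih =>
    rw [mul_add, mul_one, ComputationTree.depth_succ, decayingTree_base_two_mul_add_one, ih]

theorem decayingTree_depth_gradNode (k : ℕ) :
    (decayingTree M η).depth (M.gradNode k) = k / b * b + (M.sample k).2.2 := by
  induction k using M.localIndex_induction with
  | zero k h =>
    rw [M.gradNode_of_zero h, decayingTree_depth_two_mul, h, add_zero]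
  | succ k j h ih =>
    rw [M.gradNode_of_succ h, ComputationTree.depth_succ, decayingTree_base_two_mul, ih, h,
      M.localIndex_of_succ h, M.div_of_localIndex_succ h, add_assoc]

theorem decayingTree_mem_ancestors_two_mul {i k : ℕ} (h : i ≤ k) :
    2 * i ∈ (decayingTree M η).ancestors (2 * k) := by
  induction k, h using Nat.le_induction with
  | base => exact ComputationTree.self_mem_ancestors _ _
  | succ k _ ih =>
    rw [mul_add, mul_one]
    apply ComputationTree.mem_ancestors_succ
    rwa [decayingTree_base_two_mul_add_one]

theorem decayingTree_mem_ancestors_gradNode (k : ℕ) :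
    2 * (k / b * b) ∈ (decayingTree M η).ancestors (M.gradNode k) := by
  induction k using M.localIndex_induction with
  | zero k h =>
    rw [M.gradNode_of_zero h]
    exact ComputationTree.self_mem_ancestors _ _
  | succ k j h ih =>
    rw [M.gradNode_of_succ h, M.div_of_localIndex_succ h]
    apply ComputationTree.mem_ancestors_succ
    rwa [decayingTree_base_two_mul]

theorem decayingTree_dist_le (k : ℕ) :
    (decayingTree M η).dist (2 * k) (M.gradNode k) ≤ b - 1 := by
  refine (ComputationTree.dist_le_of_mem_ancestors _
    (decayingTree_mem_ancestors_two_mul M η (Nat.div_mul_le_self k b))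
    (decayingTree_mem_ancestors_gradNode M η k)).trans ?_
  rw [decayingTree_depth_gradNode, decayingTree_depth_two_mul, decayingTree_depth_two_mul]
  have hlocal := M.round_mul_add_localIndex_le k
  have hround := Nat.lt_div_mul_add M.pos (a := k)
  omega

theorem decayingTree_distBranch_le (k : ℕ) :
    (decayingTree M η).distBranch (M.gradNode k) (fun k => 2 * k) ≤ (M.sample k).2.2 := by
  refine (ciInf_le (OrderBot.bddBelow _) (k / b * b)).trans ?_
  refine (ComputationTree.dist_le_of_mem_ancestors _
    (decayingTree_mem_ancestors_gradNode M η k)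
    (ComputationTree.self_mem_ancestors _ _)).trans ?_
  rw [decayingTree_depth_gradNode, decayingTree_depth_two_mul]
  omega

theorem decayingTree_step_two_mul_mem_Icc (hη : 0 ≤ η) (k : ℕ) :
    (decayingTree M η).step (2 * k) ∈ Set.Icc 0
      (√(((b : ℝ) - 1) /
        ((((decayingTree M η).distBranch (M.gradNode k) (fun k => 2 * k) : ℕ) + 1) *
          (Real.log ((b : ℝ) - 1) + 1))) * η) := by
  rw [decayingTree_step_two_mul]
  have hb : (0 : ℝ) ≤ (b : ℝ) - 1 := sub_nonneg.2 (Nat.one_le_cast.2 M.pos)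
  have hlog : 0 ≤ Real.log ((b : ℝ) - 1) := by
    rw [← Nat.cast_pred M.pos]
    exact Real.log_natCast_nonneg _
  have hdist : ((decayingTree M η).distBranch (M.gradNode k) (fun k => 2 * k) : ℝ) ≤
      ((M.sample k).2.2 : ℕ) := Nat.cast_le.2 (decayingTree_distBranch_le M η k)
  refine ⟨localStep_nonneg hη _, mul_le_mul_of_nonneg_right (Real.sqrt_le_sqrt ?_) hη⟩
  gcongr

theorem decayingTree_repr_two_mul_succ (k : ℕ) :
    (decayingTree M η).repr (2 * (k + 1)) =
      (M.gradNode k, M.sample k) ::ₘ (decayingTree M η).repr (2 * k) := by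
  rw [mul_add, mul_one, ComputationTree.repr_succ, decayingTree_base_two_mul_add_one,
    decayingTree_grad_two_mul_add_one, decayingTree_label_two_mul_add_one]

theorem decayingTree_repr_mono {i k : ℕ} (h : i ≤ k) :
    (decayingTree M η).repr (2 * i) ≤ (decayingTree M η).repr (2 * k) := by
  induction k, h using Nat.le_induction with
  | base => exact le_rfl
  | succ k _ ih =>
    rw [decayingTree_repr_two_mul_succ]
    exact ih.trans (Multiset.le_cons_self _ _)

theorem decayingTree_repr_gradNode_le (k : ℕ) :
    (decayingTree M η).repr (M.gradNode k) ≤ (decayingTree M η).repr (2 * k) := by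
  induction k using M.localIndex_induction with
  | zero k h =>
    rw [M.gradNode_of_zero h]
    exact decayingTree_repr_mono M η (Nat.div_mul_le_self k b)
  | succ k j h ih =>
    rw [M.gradNode_of_succ h, ComputationTree.repr_succ, decayingTree_base_two_mul,
      decayingTree_grad_two_mul, decayingTree_label_two_mul, decayingTree_repr_two_mul_succ]
    exact Multiset.cons_le_cons _ ih

variable {E S : Type*} [AddCommGroup E] [Module ℝ E] (w₀ : E) (G : E → S → E)
  (ζ : ℕ × Fin n × ℕ → S)

theorem decayingTree_point_two_mul_succ (k : ℕ) :
    (decayingTree M η).point w₀ G ζ (2 * (k + 1)) = (decayingTree M η).point w₀ G ζ (2 * k) -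
      η • G ((decayingTree M η).point w₀ G ζ (M.gradNode k)) (ζ (M.sample k)) := by
  rw [mul_add, mul_one, ComputationTree.point_succ, decayingTree_base_two_mul_add_one,
    decayingTree_grad_two_mul_add_one, decayingTree_label_two_mul_add_one,
    decayingTree_step_two_mul_add_one]

theorem decayingTree_point_two_mul_add_one (k : ℕ) :
    (decayingTree M η).point w₀ G ζ (2 * k + 1) =
      (decayingTree M η).point w₀ G ζ (M.gradNode k) - localStep b η (M.sample k).2.2 •
        G ((decayingTree M η).point w₀ G ζ (M.gradNode k)) (ζ (M.sample k)) := by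
  rw [ComputationTree.point_succ, decayingTree_base_two_mul, decayingTree_grad_two_mul,
    decayingTree_label_two_mul, decayingTree_step_two_mul]

theorem decayingTree_point_eq (k : ℕ) :
    (decayingTree M η).point w₀ G ζ (2 * k) = mainSequence M η w₀ G ζ k ∧
      (decayingTree M η).point w₀ G ζ (M.gradNode k) = evalPoint M η w₀ G ζ k := by
  induction k using Nat.strong_induction_on with
  | _ k ih =>
    have hmain : (decayingTree M η).point w₀ G ζ (2 * k) = mainSequence M η w₀ G ζ k := by
      cases k with
      | zero => simp [ComputationTree.point, mainSequence]
      | succ k =>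
        rw [decayingTree_point_two_mul_succ, (ih k k.lt_succ_self).1, (ih k k.lt_succ_self).2,
          mainSequence, evalPoint]
    refine ⟨hmain, ?_⟩
    rcases h : (M.sample k).2.2 with _ | j
    · rw [M.gradNode_of_zero h, evalPoint, h, localPoint, localIterate, M.sample_fst,
        ← mainSequence_mul M η w₀ G ζ]
      rcases (Nat.div_mul_le_self k b).lt_or_eq with hlt | heq
      · exact (ih _ hlt).1
      · rw [heq, hmain]
    · obtain _ | k := k
      · have := M.round_mul_add_localIndex_le 0
        omega
      · rw [M.gradNode_of_succ h, decayingTree_point_two_mul_add_one, (ih k k.lt_succ_self).2,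
          evalPoint, evalPoint, M.sample_of_succ h, h]
        rfl

theorem decayingTree_point_two_mul_add_one_eq (k : ℕ) :
    (decayingTree M η).point w₀ G ζ (2 * k + 1) =
      localPoint M η w₀ G ζ (M.sample k).1 (M.sample k).2.1 ((M.sample k).2.2 + 1) := by
  rw [decayingTree_point_two_mul_add_one, (decayingTree_point_eq M η w₀ G ζ k).2]
  rfl

end Tree

/-! ### Independence of the current sample from the past -/

theorem measurable_of_factorsThrough {Ω H α : Type*} {mΩ : MeasurableSpace Ω} [Countable H]
    [MeasurableSpace H] [MeasurableSingletonClass H] [MeasurableSpace α] {g : Ω → H} {φ : Ω → α}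
    (hg : Measurable g) (hφ : φ.FactorsThrough g) : Measurable φ := by
  intro A _
  have hpre : φ ⁻¹' A = g ⁻¹' (g '' (φ ⁻¹' A)) := by
    refine (Set.subset_preimage_image _ _).antisymm ?_
    rintro ω ⟨ω', hω', heq⟩
    rwa [Set.mem_preimage, ← hφ heq]
  rw [hpre]
  exact hg (Set.to_countable _).measurableSet

section Independence

variable {Ω : Type*} [MeasurableSpace Ω] {μ : Measure Ω}

theorem indepFun_prodMk_of_prodMk [IsProbabilityMeasure μ] {α β γ : Type*} [MeasurableSpace α]
    [MeasurableSpace β] [MeasurableSpace γ] {X : Ω → α} {Y : Ω → β} {Z : Ω → γ}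
    (hX : Measurable X) (hY : Measurable Y) (hZ : Measurable Z) (hXY : IndepFun X Y μ)
    (hXYZ : IndepFun (fun ω => (X ω, Y ω)) Z μ) : IndepFun X (fun ω => (Y ω, Z ω)) μ := by
  have hYZ : IndepFun Y Z μ := hXYZ.comp measurable_snd measurable_id
  rw [indepFun_iff_map_prod_eq_prod_map_map hX.aemeasurable hY.aemeasurable] at hXY
  rw [indepFun_iff_map_prod_eq_prod_map_map hY.aemeasurable hZ.aemeasurable] at hYZ
  rw [indepFun_iff_map_prod_eq_prod_map_map (hX.prodMk hY).aemeasurable hZ.aemeasurable,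
    hXY] at hXYZ
  rw [indepFun_iff_map_prod_eq_prod_map_map hX.aemeasurable (hY.prodMk hZ).aemeasurable, hYZ]
  have := Measure.isProbabilityMeasure_map hX.aemeasurable (μ := μ)
  have := Measure.isProbabilityMeasure_map hY.aemeasurable (μ := μ)
  have := Measure.isProbabilityMeasure_map hZ.aemeasurable (μ := μ)
  rw [← (measurePreserving_prodAssoc (μ.map X) (μ.map Y) (μ.map Z)).map_eq, ← hXYZ,
    Measure.map_map MeasurableEquiv.prodAssoc.measurable ((hX.prodMk hY).prodMk hZ)]
  rfl

theorem indepFun_pi_ne {ι : Type*} {κ : ι → Type*} [∀ i, MeasurableSpace (κ i)]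
    {X : ∀ i, Ω → κ i} (hX : ∀ i, Measurable (X i)) (hind : iIndepFun X μ) (i : ι) :
    IndepFun (X i) (fun ω (j : {j // j ≠ i}) => X j ω) μ := by
  have hdisj : Disjoint {i} ({i}ᶜ : Set ι) := disjoint_compl_right
  have hle : MeasurableSpace.comap (fun ω (j : {j // j ≠ i}) => X j ω) inferInstance ≤
      ⨆ j ∈ ({i}ᶜ : Set ι), MeasurableSpace.comap (X j) inferInstance :=
    (@measurable_pi_lambda _ _ _ (_) _ _ fun j : {j // j ≠ i} =>
      measurable_iff_comap_le.2 (le_iSup₂_of_le j.1 j.2 le_rfl)).comap_le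
  rw [IndepFun_iff_Indep]
  exact indep_of_indep_of_le_left (indep_of_indep_of_le_right
    (indep_iSup_of_disjoint (fun j => (hX j).comap_le) hind.iIndep hdisj) hle)
    (le_iSup₂_of_le i (Set.mem_singleton i) le_rfl)

theorem measure_inter_eq_mul_of_fiber {H : Type*} [Countable H] [MeasurableSpace H]
    [MeasurableSingletonClass H] {g : Ω → H} (hg : Measurable g) {U E : Set Ω} {a : ENNReal}
    (hfiber : ∀ h, μ (U ∩ (g ⁻¹' {h} ∩ E)) = a * μ (g ⁻¹' {h} ∩ E)) : μ (U ∩ E) = a * μ E := by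
  have hsum (V : Set Ω) : μ V = ∑' h, μ (g ⁻¹' {h} ∩ V) := by
    have hcount := tsum_measure_preimage_singleton (μ := μ.restrict V) Set.countable_univ
      (f := g) fun h _ => hg (measurableSet_singleton h)
    rw [Set.preimage_univ, Measure.restrict_apply_univ,
      tsum_univ fun h => μ.restrict V (g ⁻¹' {h})] at hcount
    rw [← hcount]
    exact tsum_congr fun h => Measure.restrict_apply (hg (measurableSet_singleton h))
  rw [hsum (U ∩ E), hsum E, ← ENNReal.tsum_mul_left]
  exact tsum_congr fun h => by rw [Set.inter_left_comm, hfiber]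

section Selection

variable {H α β : Type*} [Countable H] [MeasurableSpace H] [MeasurableSingletonClass H]
  [MeasurableSpace α] [MeasurableSpace β] {ν : Measure α} {g : Ω → H} {X : Ω → α} {Y : Ω → β}
  {ξ : Ω → Ω → α} {υ : Ω → Ω → β}

theorem measure_preimage_inter_preimage_of_selection (hg : Measurable g)
    (hX : ∀ ω₀ ω, g ω = g ω₀ → X ω = ξ ω₀ ω) (hY : ∀ ω₀ ω, g ω = g ω₀ → Y ω = υ ω₀ ω)
    (hξ : ∀ ω₀, Measurable (ξ ω₀)) (hlaw : ∀ ω₀, μ.map (ξ ω₀) = ν)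
    (hind : ∀ ω₀, IndepFun (ξ ω₀) (fun ω => (g ω, υ ω₀ ω)) μ) {A : Set α} (hA : MeasurableSet A)
    {B : Set (H × β)} (hB : MeasurableSet B) :
    μ (X ⁻¹' A ∩ (fun ω => (g ω, Y ω)) ⁻¹' B) = ν A * μ ((fun ω => (g ω, Y ω)) ⁻¹' B) := by
  refine measure_inter_eq_mul_of_fiber hg fun h => ?_
  rcases (g ⁻¹' {h}).eq_empty_or_nonempty with hempty | ⟨ω₀, rfl⟩
  · simp [hempty]
  have hpast : g ⁻¹' {g ω₀} ∩ (fun ω => (g ω, Y ω)) ⁻¹' B =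
      (fun ω => (g ω, υ ω₀ ω)) ⁻¹' (Prod.fst ⁻¹' {g ω₀} ∩ B) := by
    ext ω
    refine and_congr_right fun hω => ?_
    simp only [Set.mem_preimage, hY ω₀ ω hω]
  have hsample : X ⁻¹' A ∩ (g ⁻¹' {g ω₀} ∩ (fun ω => (g ω, Y ω)) ⁻¹' B) =
      ξ ω₀ ⁻¹' A ∩ (g ⁻¹' {g ω₀} ∩ (fun ω => (g ω, Y ω)) ⁻¹' B) := by
    ext ω
    refine and_congr_left fun hω => ?_
    simp only [Set.mem_preimage, hX ω₀ ω hω.1]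
  rw [hsample, hpast, (hind ω₀).measure_inter_preimage_eq_mul _ _ hA
    ((measurable_fst (measurableSet_singleton _)).inter hB), ← hlaw ω₀,
    Measure.map_apply (hξ ω₀) hA]

theorem map_eq_of_selection [IsProbabilityMeasure μ] (hg : Measurable g)
    (hXm : Measurable X) (hX : ∀ ω₀ ω, g ω = g ω₀ → X ω = ξ ω₀ ω)
    (hξ : ∀ ω₀, Measurable (ξ ω₀)) (hlaw : ∀ ω₀, μ.map (ξ ω₀) = ν)
    (hind : ∀ ω₀, IndepFun (ξ ω₀) g μ) : μ.map X = ν := by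
  refine Measure.ext fun A hA => ?_
  have hinter := measure_preimage_inter_preimage_of_selection (Y := fun _ => ())
    (υ := fun _ _ => ()) hg hX (fun _ _ _ => rfl) hξ hlaw
    (fun ω₀ => (hind ω₀).comp measurable_id (measurable_id.prodMk measurable_const)) hA .univ
  simpa [Measure.map_apply hXm hA] using hinter

theorem indepFun_of_selection [IsProbabilityMeasure μ] (hg : Measurable g)
    (hXm : Measurable X) (hX : ∀ ω₀ ω, g ω = g ω₀ → X ω = ξ ω₀ ω)
    (hY : ∀ ω₀ ω, g ω = g ω₀ → Y ω = υ ω₀ ω)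
    (hξ : ∀ ω₀, Measurable (ξ ω₀)) (hlaw : ∀ ω₀, μ.map (ξ ω₀) = ν)
    (hind : ∀ ω₀, IndepFun (ξ ω₀) (fun ω => (g ω, υ ω₀ ω)) μ) :
    IndepFun X (fun ω => (g ω, Y ω)) μ := by
  have hmap : μ.map X = ν := map_eq_of_selection hg hXm hX hξ hlaw fun ω₀ =>
    (hind ω₀).comp measurable_id measurable_fst
  rw [indepFun_iff_measure_inter_preimage_eq_mul]
  intro A B hA hB
  rw [measure_preimage_inter_preimage_of_selection hg hX hY hξ hlaw hind hA hB, ← hmap,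
    Measure.map_apply hXm hA]

end Selection

end Independence

/-! ### The past of the method -/

section Past

variable {n b : ℕ} {Ω S : Type*}

/-- The numbers of local steps of the rounds `0, …, r`. -/
def roundHistory (M : Ω → Schedule n b) (r : ℕ) (ω : Ω) : Fin (r + 1) → Fin n → ℕ :=
  fun s i => (M ω).steps s i

/-- The sample `ξ^k` used by the `k`-th stochastic gradient. -/
def usedSample (M : Ω → Schedule n b) (ζ : ℕ × Fin n × ℕ → Ω → S) (k : ℕ) (ω : Ω) : S :=
  ζ ((M ω).sample k) ω

/-- What is known just before `ξ^k` is drawn: the numbers of local steps up to the current round,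
and the samples used so far. -/
def pastData (M : Ω → Schedule n b) (ζ : ℕ × Fin n × ℕ → Ω → S) (k : ℕ) (ω : Ω) :
    (Fin (k / b + 1) → Fin n → ℕ) × (Fin k → S) :=
  (roundHistory M (k / b) ω, fun p => usedSample M ζ p ω)

theorem sample_eq_of_roundHistory_eq {M : Ω → Schedule n b} {r p : ℕ} {ω ω' : Ω}
    (h : roundHistory M r ω = roundHistory M r ω') (hp : p / b ≤ r) :
    (M ω).sample p = (M ω').sample p :=
  Schedule.sample_congr (congrFun h ⟨p / b, Nat.lt_succ_of_le hp⟩)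

variable [mΩ : MeasurableSpace Ω] [MeasurableSpace S]

/-- The samples `ζ` are i.i.d. with law `D`, and those of round `r` are independent of the numbers
of local steps up to round `r` and of the earlier samples. -/
structure HasFreshSamples (μ : Measure Ω) (D : Measure S) (M : Ω → Schedule n b)
    (ζ : ℕ × Fin n × ℕ → Ω → S) : Prop where
  measurable_steps : ∀ r i, Measurable (fun ω => (M ω).steps r i)
  measurable_sample : ∀ a, Measurable (ζ a)
  law : ∀ a, μ.map (ζ a) = D
  iIndepFun : iIndepFun ζ μ
  indepFun_round : ∀ r : ℕ, IndepFun (fun ω (a : Fin n × ℕ) => ζ (r, a) ω)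
    (fun ω => (roundHistory M r ω, fun (a : Fin r × Fin n × ℕ) => ζ ((a.1 : ℕ), a.2) ω)) μ

namespace HasFreshSamples

variable {μ : Measure Ω} {D : Measure S} {M : Ω → Schedule n b} {ζ : ℕ × Fin n × ℕ → Ω → S}

theorem measurable_roundHistory (h : HasFreshSamples μ D M ζ) (r : ℕ) :
    Measurable (roundHistory M r) :=
  measurable_pi_lambda _ fun _ => measurable_pi_lambda _ fun _ => h.measurable_steps _ _

theorem measurable_usedSample (h : HasFreshSamples μ D M ζ) (k : ℕ) :
    Measurable (usedSample M ζ k) :=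
  (measurable_from_prod_countable_right (f := Function.uncurry ζ) h.measurable_sample).comp
    ((measurable_of_factorsThrough (h.measurable_roundHistory (k / b)) fun _ _ hω =>
      sample_eq_of_roundHistory_eq hω le_rfl).prodMk measurable_id)

theorem measurable_pastData (h : HasFreshSamples μ D M ζ) (k : ℕ) : Measurable (pastData M ζ k) :=
  (h.measurable_roundHistory _).prodMk (measurable_pi_lambda _ fun _ => h.measurable_usedSample _)

theorem indepFun_sample [IsProbabilityMeasure μ] (h : HasFreshSamples μ D M ζ) (r : ℕ)
    (a : Fin n × ℕ) :
    IndepFun (ζ (r, a)) (fun ω => (roundHistory M r ω,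
      fun c : {c : ℕ × Fin n × ℕ // c ≠ (r, a) ∧ c.1 ≤ r} => ζ c ω)) μ := by
  have hsame : IndepFun (ζ (r, a)) (fun ω (c : {c // c ≠ a}) => ζ (r, c) ω) μ :=
    indepFun_pi_ne (fun _ => h.measurable_sample _)
      (h.iIndepFun.precomp (Prod.mk_right_injective r)) a
  have hround : IndepFun (fun ω => (ζ (r, a) ω, fun c : {c // c ≠ a} => ζ (r, c) ω))
      (fun ω => (roundHistory M r ω, fun (c : Fin r × Fin n × ℕ) => ζ ((c.1 : ℕ), c.2) ω)) μ :=
    (h.indepFun_round r).comp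
      (φ := fun Z : Fin n × ℕ → S => (Z a, fun c : {c // c ≠ a} => Z c)) (by fun_prop)
      measurable_id
  have hall := indepFun_prodMk_of_prodMk (h.measurable_sample _)
    (measurable_pi_lambda _ fun _ => h.measurable_sample _)
    ((h.measurable_roundHistory r).prodMk (measurable_pi_lambda _ fun _ => h.measurable_sample _))
    hsame hround
  let Φ (p : ({c // c ≠ a} → S) × (Fin (r + 1) → Fin n → ℕ) × (Fin r × Fin n × ℕ → S)) :
      (Fin (r + 1) → Fin n → ℕ) × ({c : ℕ × Fin n × ℕ // c ≠ (r, a) ∧ c.1 ≤ r} → S) :=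
    (p.2.1, fun c => if hlt : c.1.1 < r then p.2.2 (⟨c.1.1, hlt⟩, c.1.2)
      else p.1 ⟨c.1.2, fun hca => c.2.1 (Prod.ext (c.2.2.antisymm (not_lt.1 hlt)) hca)⟩)
  have hΦ : Measurable Φ := by
    refine Measurable.prodMk (by fun_prop) (measurable_pi_lambda _ fun c => ?_)
    split_ifs <;> fun_prop
  refine (hall.comp measurable_id hΦ).congr (ae_of_all _ fun _ => rfl) (ae_of_all _ fun ω => ?_)
  refine congrArg (Prod.mk (roundHistory M r ω)) (funext fun c => ?_)
  by_cases hlt : c.1.1 < r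
  · simp [hlt]
  · simp [← c.2.2.antisymm (not_lt.1 hlt)]

theorem indepFun_sample_of_schedule [IsProbabilityMeasure μ] (h : HasFreshSamples μ D M ζ)
    (M₀ : Schedule n b) (k : ℕ) :
    IndepFun (ζ (M₀.sample k))
      (fun ω => (roundHistory M (k / b) ω, fun p : Fin k => ζ (M₀.sample p) ω)) μ := by
  let past (p : Fin k) : {c : ℕ × Fin n × ℕ // c ≠ M₀.sample k ∧ c.1 ≤ k / b} :=
    ⟨M₀.sample p, M₀.sample_injective.ne p.2.ne, Nat.div_le_div_right p.2.le⟩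
  exact (h.indepFun_sample (k / b) (M₀.sample k).2).comp (φ := id)
    (ψ := fun q => (q.1, fun p => q.2 (past p))) measurable_id (by fun_prop)

theorem map_usedSample [IsProbabilityMeasure μ] (h : HasFreshSamples μ D M ζ) (k : ℕ) :
    μ.map (usedSample M ζ k) = D :=
  map_eq_of_selection (ξ := fun ω₀ => ζ ((M ω₀).sample k)) (h.measurable_roundHistory (k / b))
    (h.measurable_usedSample k)
    (fun _ ω hω => congrArg (ζ · ω) (sample_eq_of_roundHistory_eq hω le_rfl))
    (fun _ => h.measurable_sample _) (fun _ => h.law _)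
    fun ω₀ => (h.indepFun_sample_of_schedule (M ω₀) k).comp measurable_id measurable_fst

theorem indepFun_usedSample_pastData [IsProbabilityMeasure μ] (h : HasFreshSamples μ D M ζ)
    (k : ℕ) : IndepFun (usedSample M ζ k) (pastData M ζ k) μ :=
  indepFun_of_selection (ξ := fun ω₀ => ζ ((M ω₀).sample k))
    (υ := fun ω₀ ω (p : Fin k) => ζ ((M ω₀).sample p) ω) (h.measurable_roundHistory (k / b))
    (h.measurable_usedSample k)
    (fun _ ω hω => congrArg (ζ · ω) (sample_eq_of_roundHistory_eq hω le_rfl))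
    (fun _ ω hω => funext fun p => congrArg (ζ · ω)
      (sample_eq_of_roundHistory_eq hω (Nat.div_le_div_right p.2.le)))
    (fun _ => h.measurable_sample _) (fun _ => h.law _)
    fun ω₀ => h.indepFun_sample_of_schedule (M ω₀) k

/-- The filtration generated by `pastData`. -/
def pastFiltration (h : HasFreshSamples μ D M ζ) : Filtration ℕ mΩ where
  seq k := MeasurableSpace.comap (pastData M ζ k) inferInstance
  mono' k l hkl := by
    let restrict (q : (Fin (l / b + 1) → Fin n → ℕ) × (Fin l → S)) :
        (Fin (k / b + 1) → Fin n → ℕ) × (Fin k → S) :=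
      (fun r => q.1 (r.castLE (Nat.succ_le_succ (Nat.div_le_div_right hkl))),
        fun p => q.2 (p.castLE hkl))
    have hrestrict : Measurable restrict := by fun_prop
    exact (hrestrict.comp (comap_measurable (pastData M ζ l))).comap_le
  le' k := (h.measurable_pastData k).comap_le

theorem measurable_pastFiltration_steps (h : HasFreshSamples μ D M ζ) {k r : ℕ} (hr : r ≤ k / b) :
    Measurable[h.pastFiltration k] (fun ω => (M ω).steps r) :=
  (show Measurable (fun q : (Fin (k / b + 1) → Fin n → ℕ) × (Fin k → S) =>
    q.1 ⟨r, Nat.lt_succ_of_le hr⟩) by fun_prop).comp (comap_measurable (pastData M ζ k))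

theorem measurable_pastFiltration_usedSample (h : HasFreshSamples μ D M ζ) {k p : ℕ} (hp : p < k) :
    Measurable[h.pastFiltration k] (usedSample M ζ p) :=
  (show Measurable (fun q : (Fin (k / b + 1) → Fin n → ℕ) × (Fin k → S) => q.2 ⟨p, hp⟩) by
    fun_prop).comp (comap_measurable (pastData M ζ k))

end HasFreshSamples

end Past

/-! ### Convergence of the method -/

namespace HasFreshSamples

variable {d n b : ℕ} {Ω S : Type*} [MeasurableSpace Ω] [MeasurableSpace S] {μ : Measure Ω}
  {D : Measure S} {M : Ω → Schedule n b} {ζ : ℕ × Fin n × ℕ → Ω → S}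
  {f : EuclideanSpace ℝ (Fin d) → ℝ}
  {G : EuclideanSpace ℝ (Fin d) → S → EuclideanSpace ℝ (Fin d)} {L σ ε η : ℝ}

theorem measurable_pastFiltration_driftCoeff (h : HasFreshSamples μ D M ζ) {k p : ℕ}
    (hp : p / b = k / b) :
    Measurable[h.pastFiltration p] fun ω => driftCoeff b η k ((M ω).sample k).2.2 p :=
  measurable_of_factorsThrough (h.measurable_pastFiltration_steps hp.ge) fun _ _ hω =>
    congrArg (fun a => driftCoeff b η k a.2.2 p) (Schedule.sample_congr hω)

variable [IsProbabilityMeasure μ]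

theorem isPerturbedSGD (h : HasFreshSamples μ D M ζ) (hη : 0 ≤ η)
    (w₀ : EuclideanSpace ℝ (Fin d)) :
    IsPerturbedSGD μ D G w₀ η h.pastFiltration
      (fun k ω => mainSequence (M ω) η w₀ G (fun a => ζ a ω) k)
      (fun k ω => evalPoint (M ω) η w₀ G (fun a => ζ a ω) k) (usedSample M ζ)
      (fun k => k / b * b) (fun k p ω => driftCoeff b η k ((M ω).sample k).2.2 p)
      (2 * (b - 1 : ℕ) * η ^ 2) where
  law := h.map_usedSample
  indep k := (IndepFun_iff_Indep _ _ _).1 (h.indepFun_usedSample_pastData k)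
  measurable_sample k := h.measurable_pastFiltration_usedSample k.lt_succ_self
  main_zero _ := rfl
  main_succ _ _ := rfl
  main_sub k ω := mainSequence_sub_evalPoint (M ω) η w₀ G _ k
  measurable_coeff k p hp := by
    obtain ⟨hle, hlt⟩ := Finset.mem_Ico.1 hp
    obtain ⟨ω⟩ := nonempty_of_isProbabilityMeasure μ
    exact h.measurable_pastFiltration_driftCoeff
      ((Nat.div_le_div_right hlt.le).antisymm ((Nat.le_div_iff_mul_le (M ω).pos).2 hle))
  sum_sq_coeff_le k ω := sum_driftCoeff_sq_le hη ((M ω).round_mul_add_localIndex_le k)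
    (Nat.lt_div_mul_add (M ω).pos)

theorem indepFun_usedSample_past (h : HasFreshSamples μ D M ζ) (hη : 0 ≤ η)
    (hG : Measurable fun p : EuclideanSpace ℝ (Fin d) × S => G p.1 p.2)
    (w₀ : EuclideanSpace ℝ (Fin d)) (k : ℕ) :
    IndepFun (usedSample M ζ k) (fun ω (i : Fin k) =>
      (mainSequence (M ω) η w₀ G (fun a => ζ a ω) (i + 1),
        evalPoint (M ω) η w₀ G (fun a => ζ a ω) (i + 1), usedSample M ζ i ω)) μ := by
  have hP := h.isPerturbedSGD (G := G) hη w₀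
  refine (hP.indepFun_sample
    (@measurable_pi_lambda _ _ _ (h.pastFiltration k) _ _ fun i => ?_)).symm
  have hmono : h.pastFiltration (i + 1) ≤ h.pastFiltration k := h.pastFiltration.mono i.2
  exact ((hP.measurable_main hG (i + 1)).mono hmono le_rfl).prodMk
    (((hP.measurable_eval hG (i + 1)).mono hmono le_rfl).prodMk
      (h.measurable_pastFiltration_usedSample i.2))

theorem mainConditions_decayingTree (h : HasFreshSamples μ D M ζ) (hb : 0 < b)
    (hG : Measurable fun p : EuclideanSpace ℝ (Fin d) × S => G p.1 p.2)
    (w₀ : EuclideanSpace ℝ (Fin d)) (hL : 0 < L) (hε : 0 < ε) (hη : η = globalStep b L σ ε) :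
    MainConditions μ D w₀ G ζ (fun ω => decayingTree (M ω) η)
      (fun _ k => 2 * k) (fun _ _ => η) (fun ω k => (M ω).gradNode k)
      (fun ω k => (M ω).sample k) L σ ε ((b : ℝ) - 1) η := by
  have hη0 : 0 < η := hη ▸ globalStep_pos hb hL hε
  exact
  { branch ω := decayingTree_isMainBranch (M ω) η hη0
    law k := ⟨h.measurable_usedSample k, h.map_usedSample k⟩
    indep k := by
      simp only [(decayingTree_point_eq _ η w₀ G _ _).1, (decayingTree_point_eq _ η w₀ G _ _).2]
      exact h.indepFun_usedSample_past hη0.le hG w₀ k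
    repr_le ω k := decayingTree_repr_gradNode_le (M ω) η k
    dist_le ω k := by
      rw [← Nat.cast_one, ← Nat.cast_sub hb]
      exact Nat.cast_le.2 (decayingTree_dist_le (M ω) η k)
    step_eq _ _ := rfl
    step_le := by
      have hstep : 4 * b * L * η ≤ 1 := hη ▸ four_mul_globalStep_le_one hb hL
      have hLη : L * η ≤ b * (L * η) :=
        le_mul_of_one_le_left (mul_pos hL hη0).le (Nat.one_le_cast.2 hb)
      exact ⟨by nlinarith [mul_pos hL hη0], by nlinarith [mul_pos hL hη0],
        hη ▸ sq_mul_globalStep_le hL hε.le⟩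
    other_step_le ω e he := by
      obtain ⟨k, rfl | rfl⟩ := e.even_or_odd'
      · rw [decayingTree_base_two_mul]
        exact decayingTree_step_two_mul_mem_Icc (M ω) η hη0.le k
      · exact absurd rfl (he k) }

theorem sum_integral_norm_gradient_sq_le [IsProbabilityMeasure D] (h : HasFreshSamples μ D M ζ)
    (hf : IsSmooth f L) (hbdd : BddBelow (Set.range f)) (hG : IsStochasticGradient f G D σ)
    (w₀ : EuclideanSpace ℝ (Fin d)) (hb : 0 < b) (hL : 0 < L) (hε : 0 < ε)
    (hη : η = globalStep b L σ ε) {K : ℕ}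
    (hK : 8 * b * L * (f w₀ - ⨅ y, f y) / ε + 16 * σ ^ 2 * L * (f w₀ - ⨅ y, f y) / ε ^ 2 ≤ K) :
    ∑ k ∈ Finset.range K,
      ∫ ω, ‖gradient f (mainSequence (M ω) η w₀ G (fun a => ζ a ω) k)‖ ^ 2 ∂μ ≤ ε * K := by
  have hη0 : 0 < η := hη ▸ globalStep_pos hb hL hε
  have hstep : 4 * ((b - 1 : ℕ) + 1) * L * η ≤ 1 := by
    rw [← Nat.cast_succ, Nat.succ_eq_add_one, Nat.sub_add_cancel hb, hη]
    exact four_mul_globalStep_le_one hb hL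
  have hwindow (k : ℕ) : k ≤ k / b * b + (b - 1) := by
    have := Nat.lt_div_mul_add hb (a := k)
    omega
  exact le_of_globalStep_bound hb hL hε (sub_nonneg.2 (ciInf_le hbdd w₀)) hK hη
    ((h.isPerturbedSGD hη0.le w₀).sum_integral_norm_gradient_main_sq_le hf hG hbdd hL.le hη0 hstep
      hwindow rfl K)

end HasFreshSamples

end BirchSGD

/-- Convergence of asynchronous Decaying Local SGD. The numbers of local steps may be random and may
depend on the past: the samples of a round are only required to be independent of the numbers of
local steps up to that round and of the earlier samples. -/
theorem mainTheorem12
    {d n b : ℕ} {Ω S : Type*} [MeasurableSpace Ω] [MeasurableSpace S]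
    (μ : Measure Ω) [IsProbabilityMeasure μ] (D : Measure S) [IsProbabilityMeasure D]
    (f : EuclideanSpace ℝ (Fin d) → ℝ)
    (G : EuclideanSpace ℝ (Fin d) → S → EuclideanSpace ℝ (Fin d))
    (w₀ : EuclideanSpace ℝ (Fin d)) (L σ ε : ℝ)
    (hL : 0 < L) (hσ : 0 ≤ σ) (hε : 0 < ε)
    (hf : IsSmooth f L) (hbdd : BddBelow (Set.range f))
    (hG : IsStochasticGradient f G D σ)
    (M : Ω → Schedule n b) (hM : ∀ r i, Measurable (fun ω => (M ω).steps r i))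
    (ζ : ℕ × Fin n × ℕ → Ω → S) (hζ : ∀ a, Measurable (ζ a))
    (hlaw : ∀ a, μ.map (ζ a) = D) (hindep : iIndepFun ζ μ)
    (hMζ : ∀ r : ℕ, IndepFun
      (fun ω (a : Fin n × ℕ) => ζ (r, a) ω)
      (fun ω => ((fun (s : Fin (r + 1)) (i : Fin n) => (M ω).steps s i),
        (fun (a : Fin r × Fin n × ℕ) => ζ ((a.1 : ℕ), a.2) ω))) μ)
    (η : ℝ) (hη : η = globalStep b L σ ε)
    (x : ℕ → Ω → EuclideanSpace ℝ (Fin d))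
    (hx : ∀ k ω, x k ω = mainSequence (M ω) η w₀ G (fun a => ζ a ω) k) :
    -- The sequence is the one displayed in the theorem, and it passes through the global models.
    (∀ ω (r : ℕ) (i : Fin n) (j : ℕ), j < (M ω).steps r i →
      x (r * b + ∑ l ∈ Finset.univ.filter (· < i), (M ω).steps r l + j + 1) ω =
        x (r * b + ∑ l ∈ Finset.univ.filter (· < i), (M ω).steps r l + j) ω -
          η • G (localPoint (M ω) η w₀ G (fun a => ζ a ω) r i j) (ζ (r, i, j) ω)) ∧
    (∀ ω (r : ℕ), x (r * b) ω = globalModel (M ω) η w₀ G (fun a => ζ a ω) r) ∧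
    -- The nodes of the tree carry the points of the algorithm.
    (∀ ω (k : ℕ),
      (decayingTree (M ω) η).point w₀ G (fun a => ζ a ω) (2 * k) = x k ω ∧
      (decayingTree (M ω) η).point w₀ G (fun a => ζ a ω) ((M ω).gradNode k) =
        localPoint (M ω) η w₀ G (fun a => ζ a ω) ((M ω).sample k).1 ((M ω).sample k).2.1
          ((M ω).sample k).2.2 ∧
      (decayingTree (M ω) η).point w₀ G (fun a => ζ a ω) (2 * k + 1) =
        localPoint (M ω) η w₀ G (fun a => ζ a ω) ((M ω).sample k).1 ((M ω).sample k).2.1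
          (((M ω).sample k).2.2 + 1)) ∧
    -- The sequence is a main branch satisfying the conditions of the main theorem, `R = b - 1`.
    MainConditions μ D w₀ G ζ (fun ω => decayingTree (M ω) η)
      (fun _ k => 2 * k) (fun _ _ => η) (fun ω k => (M ω).gradNode k)
      (fun ω k => (M ω).sample k) L σ ε ((b : ℝ) - 1) η ∧
    -- The convergence rate.
    (∀ k, Integrable (fun ω => ‖gradient f (x k ω)‖ ^ 2) μ) ∧
    ∀ K : ℕ,
      8 * b * L * (f w₀ - ⨅ y, f y) / ε + 16 * σ ^ 2 * L * (f w₀ - ⨅ y, f y) / ε ^ 2 ≤ (K : ℝ) →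
      1 / (K : ℝ) * ∑ k ∈ Finset.range K, ∫ ω, ‖gradient f (x k ω)‖ ^ 2 ∂μ ≤ ε := by
  have hb : 0 < b := by
    obtain ⟨ω⟩ := nonempty_of_isProbabilityMeasure μ
    exact (M ω).pos
  obtain rfl : x = fun k ω => mainSequence (M ω) η w₀ G (fun a => ζ a ω) k :=
    funext fun k => funext (hx k)
  have hη0 : 0 < η := hη ▸ globalStep_pos hb hL hε
  have hfresh : HasFreshSamples μ D M ζ := ⟨hM, hζ, hlaw, hindep, hMζ⟩
  have hP := hfresh.isPerturbedSGD (G := G) hη0.le w₀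
  refine ⟨fun ω r i j hj => mainSequence_succ_of_lt (M ω) η w₀ G _ hj,
    fun ω r => mainSequence_mul (M ω) η w₀ G _ r,
    fun ω k => ⟨(decayingTree_point_eq (M ω) η w₀ G _ k).1,
      (decayingTree_point_eq (M ω) η w₀ G _ k).2,
      decayingTree_point_two_mul_add_one_eq (M ω) η w₀ G _ k⟩,
    hfresh.mainConditions_decayingTree hb hG.measurable w₀ hL hε hη,
    fun k => (hP.memLp_gradient_main hf hG k).integrable_norm_pow two_ne_zero, fun K hK => ?_⟩
  obtain rfl | hK0 := K.eq_zero_or_pos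
  · simpa using hε.le
  · rw [one_div, inv_mul_le_iff₀ (Nat.cast_pos.2 hK0), mul_comm]
    exact hfresh.sum_integral_norm_gradient_sq_le hf hbdd hG w₀ hb hL hε hη hK
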